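/- Let $G$ be a finite simple graph with maximum degree at most $3$ that is outerplanar, i.e. it has a planar embedding in which every vertex lies on the boundary of the outer face. A $2$-tone $6$-coloring of $G$ is a map $f$ assigning to each vertex a $2$-element subset of $\{1,\dots,6\}$ such that $|f(u)\cap f(v)|<d_G(u,v)$ for all distinct vertices $u,v$ (with $d_G(u,v)=\infty$ if $u,v$ lie in different components); it is good if $|f(u)\cap f(v)|=1$ whenever $d_G(u,v)=2$. Then $G$ admits a good $2$-tone $6$-coloring if and only if $G$ does not contain $K_4-e$ (the complete graph on four vertices minus one edge) as a subgraph, not necessarily induced. In particular, if $G$ does not contain $K_4-e$, then $G$ has a $2$-tone $6$-coloring. -/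

import Mathlib

namespace ToneColoring

/-- `A` is a simple arc in the plane `ℂ` with end points `p` and `q`. -/
def IsArc (A : Set ℂ) (p q : ℂ) : Prop :=
  ∃ γ : Path p q, Function.Injective γ ∧ Set.range γ = A

/-- A planar embedding of a simple graph: the vertices are distinct points of the plane `ℂ`, the
edges are simple arcs joining their two ends, an edge passes through no vertex other than its two
ends, and two distinct edges meet only in common ends. (`edge` is relevant only on the edges
of `G`.) -/
structure PlanarEmbedding {V : Type*} (G : SimpleGraph V) where
  point : V → ℂ
  edge : Sym2 V → Set ℂ
  point_injective : Function.Injective point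
  isArc_edge : ∀ u v, G.Adj u v → IsArc (edge s(u, v)) (point u) (point v)
  mem_of_point_mem : ∀ e ∈ G.edgeSet, ∀ w, point w ∈ edge e → w ∈ e
  inter_edge : ∀ e ∈ G.edgeSet, ∀ f ∈ G.edgeSet, e ≠ f →
    ∀ z ∈ edge e ∩ edge f, ∃ w, w ∈ e ∧ w ∈ f ∧ point w = z

namespace PlanarEmbedding

variable {V : Type*} {G : SimpleGraph V}

/-- The subset of the plane covered by the drawing. -/
def support (E : PlanarEmbedding G) : Set ℂ :=
  Set.range E.point ∪ ⋃ e ∈ G.edgeSet, E.edge e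

/-- A face is a connected component of the complement of the drawing. -/
def IsFace (E : PlanarEmbedding G) (F : Set ℂ) : Prop :=
  ∃ z ∈ E.supportᶜ, F = connectedComponentIn E.supportᶜ z

/-- The outer face of a finite plane graph is its unbounded face. -/
def IsOuterFace (E : PlanarEmbedding G) (F : Set ℂ) : Prop :=
  E.IsFace F ∧ ¬ Bornology.IsBounded F

end PlanarEmbedding

/-- A (finite) graph is outerplanar if it has a planar embedding in which every vertex lies on the
boundary of the outer face. -/
def IsOuterplanar {V : Type*} (G : SimpleGraph V) : Prop :=
  ∃ (E : PlanarEmbedding G) (F : Set ℂ), E.IsOuterFace F ∧ ∀ v, E.point v ∈ frontier F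

/-- `f` is a `t`-tone `k`-coloring of `G`: every label `f v` is a `t`-element set of colors, and
distinct vertices at distance `d` share fewer than `d` colors. The distance is the extended one:
there is no condition on vertices in different components. -/
structure IsToneColoring {V : Type*} (G : SimpleGraph V) (t k : ℕ) (f : V → Finset (Fin k)) :
    Prop where
  card_eq : ∀ v, (f v).card = t
  card_inter_lt : ∀ u v, u ≠ v → ((f u ∩ f v).card : ℕ∞) < G.edist u v

/-- A good `2`-tone `k`-coloring: a `2`-tone `k`-coloring in which any two vertices at distance two
share exactly one color. -/
structure IsGoodTwoToneColoring {V : Type*} (G : SimpleGraph V) (k : ℕ) (f : V → Finset (Fin k)) :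
    Prop where
  isToneColoring : IsToneColoring G 2 k f
  card_inter_eq_one : ∀ u v, G.edist u v = 2 → (f u ∩ f v).card = 1

/-- The graph `K₄ - e`: the complete graph on four vertices with one edge removed. -/
def K4MinusEdge : SimpleGraph (Fin 4) :=
  (⊤ : SimpleGraph (Fin 4)).deleteEdges {s(0, 1)}

end ToneColoring

/-! ### Continuous logarithms and the nonplanarity of `K₃,₃`. -/

namespace ToneColoring

open Complex

/-! If `K₄ - e` is contained in `G`, its two nonadjacent vertices both receive the two colors
missing on the edge joining the other two; they share two colors at distance at most two, which is
forbidden.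

For the converse, outerplanarity is used only through the combinatorial property `NoTheta`. Two hubs
and three targets violating it, together with a face having all vertices on its boundary as a third
hub, would draw `K₃,₃` in the plane (`IsOuterplanar.noTheta`). That this is impossible is proved by
a parity count of winding numbers (`not_joinedIn_of_disjoint`).

The coloring is built by induction on the edge set. A pendant vertex can be removed and colored
afterwards (`exists_locGood_of_pendant`). If every non-isolated vertex has at least two neighbours,
a lasso (a path whose end is joined back to an earlier vertex) with longest possible tail yields an
ear: a path with adjacent ends and inner vertices of degree two (`exists_earList`). In the remaining
configurations the degree bound, the absence of `K₄ - e` or `NoTheta` is violated, or the tail can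
be lengthened.

After deletion of the inner vertices of an ear the rest is colored by induction and the coloring is
extended along the ear (`IsEar.exists_extension`). For one inner vertex the complement of the colors
of the ends works, because `K₄ - e` is absent. For more inner vertices each end has at most one
further neighbour, and a suitable sequence of pairs is found by finite computation up to the
symmetry of the six colors, and by induction for long ears (`exists_walk`). -/

/-- The total change of a continuous logarithm of `g - a` along `[0, 1]` is `d`. -/
def LogChange (g : ℝ → ℂ) (a d : ℂ) : Prop :=
  ∃ L : ℝ → ℂ, Continuous L ∧ (∀ t, exp (L t) = g t - a) ∧ d = L 1 - L 0

theorem LogChange.unique {g : ℝ → ℂ} {a d d' : ℂ} (h : LogChange g a d) (h' : LogChange g a d') :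
    d = d' := by
  obtain ⟨L, hL, hexp, rfl⟩ := h
  obtain ⟨L', hL', hexp', rfl⟩ := h'
  have h0 : exp (L 0 - L' 0) = 1 := by
    rw [exp_sub, hexp, ← hexp', div_self (exp_ne_zero _)]
  have key : L = fun t ↦ L' t + (L 0 - L' 0) := by
    refine isCoveringMap_exp.eq_of_comp_eq hL (by fun_prop) ?_ 0 (by simp)
    funext t
    simp [Function.comp, exp_add, h0, hexp, hexp']
  rw [congrFun key 1]
  ring

theorem exists_log_of_ne_zero {F : ℝ × ℝ → ℂ} (hF : Continuous F) (h0 : ∀ x, F x ≠ 0) :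
    ∃ L : ℝ × ℝ → ℂ, Continuous L ∧ ∀ x, exp (L x) = F x := by
  obtain ⟨L, ⟨-, hL⟩, -⟩ := isCoveringMapOn_exp.existsUnique_continuousMap_lifts
    (⟨F, hF⟩ : C(ℝ × ℝ, ℂ)) (a₀ := (0, 0)) (e₀ := log (F (0, 0))) (exp_log (h0 _))
    (fun x ↦ h0 x)
  exact ⟨L, L.continuous, fun x ↦ congrFun hL x⟩

theorem exists_logChange {g : ℝ → ℂ} (hg : Continuous g) {a : ℂ} (ha : ∀ t, g t ≠ a) :
    ∃ d, LogChange g a d := by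
  obtain ⟨L, hL, hexp⟩ := exists_log_of_ne_zero (F := fun x ↦ g x.1 - a) (by fun_prop)
    (fun x ↦ sub_ne_zero.2 (ha _))
  exact ⟨_, fun t ↦ L (t, 0), by fun_prop, fun t ↦ hexp _, rfl⟩

theorem LogChange.exists_int {g : ℝ → ℂ} {a d l₀ l₁ : ℂ} (h : LogChange g a d)
    (h₀ : exp l₀ = g 0 - a) (h₁ : exp l₁ = g 1 - a) :
    ∃ n : ℤ, d = l₁ - l₀ + n * (2 * Real.pi * I) := by
  obtain ⟨L, hL, hexp, rfl⟩ := h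
  rw [← exp_eq_exp_iff_exists_int]
  rw [exp_sub, exp_sub, hexp, hexp, h₀, h₁]

/-- The function `g s - h t` has no zero, so it has a logarithm on the whole simply connected plane;
both sides are its change between opposite corners of the unit square, along the two boundary
routes. Adding `π i` turns it into a logarithm of `h t - g s`. -/
theorem logChange_square {g h : ℝ → ℂ} (hg : Continuous g) (hh : Continuous h)
    (hne : ∀ s t, g s ≠ h t) {d₀ d₁ e₀ e₁ : ℂ} (hd₀ : LogChange g (h 0) d₀)
    (hd₁ : LogChange g (h 1) d₁) (he₀ : LogChange h (g 0) e₀) (he₁ : LogChange h (g 1) e₁) :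
    d₀ + e₁ = e₀ + d₁ := by
  obtain ⟨L, hL, hexp⟩ := exists_log_of_ne_zero (F := fun x ↦ g x.1 - h x.2) (by fun_prop)
    (fun x ↦ sub_ne_zero.2 (hne _ _))
  have hg' : ∀ t, LogChange g (h t) (L (1, t) - L (0, t)) := fun t ↦
    ⟨fun s ↦ L (s, t), by fun_prop, fun s ↦ hexp _, rfl⟩
  have hh' : ∀ s, LogChange h (g s) (L (s, 1) - L (s, 0)) := fun s ↦
    ⟨fun t ↦ L (s, t) + Real.pi * I, by fun_prop, fun t ↦ by
      rw [exp_add, hexp, exp_pi_mul_I]; simp, by ring⟩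
  rw [hd₀.unique (hg' 0), hd₁.unique (hg' 1), he₀.unique (hh' 0), he₁.unique (hh' 1)]
  ring

/-- A system of logarithms of the differences of distinct points of a linearly ordered family,
in which the logarithms of opposite differences differ by `π i`. -/
theorem exists_log_differences {ι : Type*} [LinearOrder ι] {a : ι → ℂ}
    (ha : Function.Injective a) :
    ∃ l : ι → ι → ℂ, (∀ i j, i ≠ j → exp (l i j) = a j - a i) ∧
      ∀ i j, i < j → l j i = l i j + Real.pi * I := by
  refine ⟨fun i j ↦ if i < j then log (a j - a i) else log (a i - a j) + Real.pi * I, ?_, ?_⟩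
  · intro i j hij
    have h1 : a j - a i ≠ 0 := sub_ne_zero.2 (ha.ne hij.symm)
    have h2 : a i - a j ≠ 0 := sub_ne_zero.2 (ha.ne hij)
    dsimp only
    split_ifs with h
    · rw [exp_log h1]
    · rw [exp_add, exp_log h2, exp_pi_mul_I]; ring
  · intro i j hij
    simp [hij, hij.not_gt]

/-- The complete bipartite graph `K₃,₃` cannot be drawn in the plane in such a way that edges
without common end are disjoint. -/
theorem not_joinedIn_of_disjoint {a b : Fin 3 → ℂ} {S : Fin 3 → Fin 3 → Set ℂ}
    (hS : ∀ i j, JoinedIn (S i j) (a i) (b j))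
    (hdisj : ∀ i i' j j', i ≠ i' → j ≠ j' → Disjoint (S i j) (S i' j')) : False := by
  choose γ hγ using hS
  -- The paths are continued as constants outside the unit interval, since `LogChange` asks for
  -- logarithms on all of `ℝ`.
  let g : Fin 3 → Fin 3 → ℝ → ℂ := fun i j ↦ (γ i j).extend
  have hgc : ∀ i j, Continuous (g i j) := fun i j ↦ (γ i j).continuous_extend
  have hg0 : ∀ i j, g i j 0 = a i := fun i j ↦ (γ i j).extend_zero
  have hg1 : ∀ i j, g i j 1 = b j := fun i j ↦ (γ i j).extend_one
  have hgS : ∀ i j t, g i j t ∈ S i j := fun i j t ↦ hγ i j _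
  have hgg : ∀ i i' j j', i ≠ i' → j ≠ j' → ∀ s t, g i j s ≠ g i' j' t := by
    intro i i' j j' hi hj s t h
    exact Set.disjoint_left.1 (hdisj i i' j j' hi hj) (hgS i j s) (h ▸ hgS i' j' t)
  have hother : ∀ i : Fin 3, ∃ j, j ≠ i := by decide
  have hga : ∀ i' i j, i' ≠ i → ∀ t, g i j t ≠ a i' := by
    intro i' i j h t
    obtain ⟨j', hj'⟩ := hother j
    rw [← hg0 i' j']
    exact hgg _ _ _ _ h.symm hj'.symm _ _
  have hgb : ∀ j' i j, j' ≠ j → ∀ t, g i j t ≠ b j' := by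
    intro j' i j h t
    obtain ⟨i', hi'⟩ := hother i
    rw [← hg1 i' j']
    exact hgg _ _ _ _ hi'.symm h.symm _ _
  have ha : Function.Injective a := by
    intro i i' h
    by_contra hne
    exact hga i i' 0 hne 0 ((hg0 i' 0).trans h.symm)
  have hb : Function.Injective b := by
    intro i i' h
    by_contra hne
    exact hgb i 0 i' hne 1 ((hg1 0 i').trans h.symm)
  have hab : ∀ i j, b j - a i ≠ 0 := by
    intro i j
    obtain ⟨i', hi'⟩ := hother i
    rw [sub_ne_zero, ← hg1 i' j]
    exact hga _ _ _ hi'.symm 1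
  obtain ⟨la, hla, hla'⟩ := exists_log_differences ha
  obtain ⟨lb, hlb, hlb'⟩ := exists_log_differences hb
  -- The change about a vertex is compared with fixed logarithms of the differences of the vertices.
  -- With these choices the logarithms of the `b j - a i` cancel in each square relation, and only
  -- integers and the jumps by `π i` from `hla'` and `hlb'` survive.
  have hn : ∀ i' i j, ∃ n : ℤ, i' ≠ i → LogChange (g i j) (a i')
      (log (b j - a i') - la i' i + n * (2 * Real.pi * I)) := by
    intro i' i j
    by_cases h : i' = i
    · exact ⟨0, fun h' ↦ (h' h).elim⟩
    obtain ⟨d, hd⟩ := exists_logChange (hgc i j) (hga i' i j h)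
    obtain ⟨n, rfl⟩ := hd.exists_int (l₀ := la i' i) (l₁ := log (b j - a i'))
      (by rw [hla _ _ h, hg0]) (by rw [exp_log (hab _ _), hg1])
    exact ⟨n, fun _ ↦ hd⟩
  have hm : ∀ j' i j, ∃ n : ℤ, j' ≠ j → LogChange (g i j) (b j')
      (lb j' j - (log (b j' - a i) + Real.pi * I) + n * (2 * Real.pi * I)) := by
    intro j' i j
    by_cases h : j' = j
    · exact ⟨0, fun h' ↦ (h' h).elim⟩
    obtain ⟨d, hd⟩ := exists_logChange (hgc i j) (hgb j' i j h)
    obtain ⟨n, rfl⟩ := hd.exists_int (l₀ := log (b j' - a i) + Real.pi * I) (l₁ := lb j' j)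
      (by rw [exp_add, exp_log (hab _ _), exp_pi_mul_I, hg0]; ring) (by rw [hlb _ _ h, hg1])
    exact ⟨n, fun _ ↦ hd⟩
  choose n hn using hn
  choose m hm using hm
  have hpi : (2 * Real.pi * I : ℂ) ≠ 0 := by simp [Real.pi_ne_zero]
  have key : ∀ i i' j j', i < i' → j ≠ j' →
      n i' i j + m j i' j' - n i i' j' - m j' i j = if j < j' then 1 else 0 := by
    intro i i' j j' hi hj
    have h1 := hn i' i j hi.ne'
    have h2 := hm j' i j hj.symm
    have h3 := hn i i' j' hi.ne
    have h4 := hm j i' j' hj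
    have := logChange_square (hgc i j) (hgc i' j') (hgg _ _ _ _ hi.ne hj)
      (by rw [hg0]; exact h1) (by rw [hg1]; exact h2) (by rw [hg0]; exact h3)
      (by rw [hg1]; exact h4)
    rw [hla' _ _ hi] at this
    rcases lt_or_gt_of_ne hj with hj | hj
    · rw [hlb' _ _ hj] at this
      rw [if_pos hj]
      have h : ((n i' i j + m j i' j' - n i i' j' - m j' i j : ℤ) : ℂ) * (2 * Real.pi * I)
          = (1 : ℤ) * (2 * Real.pi * I) := by
        push_cast
        linear_combination this
      exact_mod_cast mul_right_cancel₀ hpi h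
    · rw [hlb' _ _ hj] at this
      rw [if_neg hj.not_gt]
      have h : ((n i' i j + m j i' j' - n i i' j' - m j' i j : ℤ) : ℂ) * (2 * Real.pi * I)
          = (0 : ℤ) * (2 * Real.pi * I) := by
        push_cast
        linear_combination this
      exact_mod_cast mul_right_cancel₀ hpi h
  have k1 := fun j j' ↦ key 0 1 j j' (by decide)
  have k2 := fun j j' ↦ key 0 2 j j' (by decide)
  have k3 := fun j j' ↦ key 1 2 j j' (by decide)
  have := k1 0 1 (by decide)
  have := k1 0 2 (by decide)
  have := k1 1 2 (by decide)
  have := k1 1 0 (by decide)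
  have := k1 2 0 (by decide)
  have := k1 2 1 (by decide)
  have := k2 0 1 (by decide)
  have := k2 0 2 (by decide)
  have := k2 1 2 (by decide)
  have := k2 1 0 (by decide)
  have := k2 2 0 (by decide)
  have := k2 2 1 (by decide)
  have := k3 0 1 (by decide)
  have := k3 0 2 (by decide)
  have := k3 1 2 (by decide)
  have := k3 1 0 (by decide)
  have := k3 2 0 (by decide)
  have := k3 2 1 (by decide)
  simp only [show (0 : Fin 3) < 1 by decide, show (0 : Fin 3) < 2 by decide,
    show (1 : Fin 3) < 2 by decide, show ¬ (1 : Fin 3) < 0 by decide,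
    show ¬ (2 : Fin 3) < 0 by decide, show ¬ (2 : Fin 3) < 1 by decide, if_true, if_false] at *
  -- A parity contradiction: the 18 relations correspond to the pairs of disjoint edges. Each `n`
  -- and each `m` belongs to an edge and a vertex off it, hence occurs with coefficient `±1` in
  -- exactly two relations, so the left sides add up to an even number. The right sides add up to 9.
  omega

end ToneColoring

/-! ### From outerplanarity to the absence of thetas. -/

namespace ToneColoring

/-- The vertices `x` and `y` are joined by a walk all of whose vertices lie in `A`. -/
def ConnIn {V : Type*} (G : SimpleGraph V) (A : Set V) (x y : V) : Prop :=
  ∃ p : G.Walk x y, ∀ z ∈ p.support, z ∈ A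

/-- There are no two hubs `p`, `q` and three vertices `w i` with connections `S i` from `p` to
`w i` and `T i` from `q` to `w i` such that `S i` and `T j` are disjoint for `i ≠ j`. -/
def NoTheta {V : Type*} (G : SimpleGraph V) : Prop :=
  ∀ (p q : V) (w : Fin 3 → V) (S T : Fin 3 → Set V), (∀ i, ConnIn G (S i) p (w i)) →
    (∀ i, ConnIn G (T i) q (w i)) → ¬ ∀ i j, i ≠ j → Disjoint (S i) (T j)

section ConnIn

variable {V : Type*} {G H : SimpleGraph V} {A B : Set V} {x y z : V}

theorem ConnIn.refl (h : x ∈ A) : ConnIn G A x x := ⟨.nil, by simpa⟩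

theorem ConnIn.symm (h : ConnIn G A x y) : ConnIn G A y x := by
  obtain ⟨p, hp⟩ := h
  exact ⟨p.reverse, by simpa⟩

theorem ConnIn.trans (h : ConnIn G A x y) (h' : ConnIn G A y z) : ConnIn G A x z := by
  obtain ⟨p, hp⟩ := h
  obtain ⟨q, hq⟩ := h'
  refine ⟨p.append q, fun z hz ↦ ?_⟩
  rw [SimpleGraph.Walk.mem_support_append_iff] at hz
  exact hz.elim (hp z) (hq z)

theorem ConnIn.of_adj (h : G.Adj x y) (hx : x ∈ A) (hy : y ∈ A) : ConnIn G A x y :=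
  ⟨h.toWalk, by simp [hx, hy]⟩

theorem ConnIn.mono (h : ConnIn G A x y) (hAB : A ⊆ B) : ConnIn G B x y := by
  obtain ⟨p, hp⟩ := h
  exact ⟨p, fun z hz ↦ hAB (hp z hz)⟩

theorem ConnIn.left_mem (h : ConnIn G A x y) : x ∈ A := by
  obtain ⟨p, hp⟩ := h
  exact hp x p.start_mem_support

theorem ConnIn.right_mem (h : ConnIn G A x y) : y ∈ A := h.symm.left_mem

theorem ConnIn.mono_graph (h : ConnIn G A x y) (hGH : G ≤ H) : ConnIn H A x y := by
  obtain ⟨p, hp⟩ := h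
  exact ⟨p.mapLe hGH, by simpa using hp⟩

theorem NoTheta.mono (h : NoTheta H) (hGH : G ≤ H) : NoTheta G :=
  fun p q w S T hS hT ↦ h p q w S T (fun i ↦ (hS i).mono_graph hGH)
    (fun i ↦ (hT i).mono_graph hGH)

end ConnIn

namespace PlanarEmbedding

variable {V : Type*} {G : SimpleGraph V} (E : PlanarEmbedding G)

/-- The part of the drawing that represents the subgraph induced on `A`. -/
def region (A : Set V) : Set ℂ :=
  E.point '' A ∪ ⋃ e ∈ {e ∈ G.edgeSet | ∀ v ∈ e, v ∈ A}, E.edge e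

theorem region_subset_support (A : Set V) : E.region A ⊆ E.support := by
  refine Set.union_subset_union (Set.image_subset_range _ _) ?_
  exact Set.biUnion_subset_biUnion_left fun e he ↦ he.1

theorem support_eq_region : E.support = E.region Set.univ := by
  simp [support, region]

theorem disjoint_region {A B : Set V} (h : Disjoint A B) : Disjoint (E.region A) (E.region B) := by
  rw [Set.disjoint_left] at h ⊢
  rintro z (⟨v, hv, rfl⟩ | hz) (⟨w, hw, hwz⟩ | hz')
  · exact h hv (E.point_injective hwz ▸ hw)
  · simp only [Set.mem_iUnion] at hz'
    obtain ⟨e, he, hze⟩ := hz'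
    exact h hv (he.2 _ (E.mem_of_point_mem e he.1 v hze))
  · simp only [Set.mem_iUnion] at hz
    obtain ⟨e, he, hze⟩ := hz
    exact h (he.2 _ (E.mem_of_point_mem e he.1 w (hwz ▸ hze))) hw
  · simp only [Set.mem_iUnion] at hz hz'
    obtain ⟨e, he, hze⟩ := hz
    obtain ⟨f, hf, hzf⟩ := hz'
    by_cases hef : e = f
    · subst hef
      obtain ⟨v, hv⟩ : ∃ v, v ∈ e := e.inductionOn fun a b ↦ ⟨a, by simp⟩
      exact h (he.2 v hv) (hf.2 v hv)
    · obtain ⟨w, hwe, hwf, -⟩ := E.inter_edge e he.1 f hf.1 hef z ⟨hze, hzf⟩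
      exact h (he.2 w hwe) (hf.2 w hwf)

theorem isClosed_region [Finite V] (A : Set V) : IsClosed (E.region A) := by
  refine IsClosed.union (Set.toFinite _).isClosed ?_
  refine Set.Finite.isClosed_biUnion (Set.toFinite _) fun e he ↦ ?_
  induction e using Sym2.inductionOn with
  | hf u v =>
    obtain ⟨γ, -, hγ⟩ := E.isArc_edge u v he.1
    rw [← hγ]
    exact (isCompact_range γ.continuous).isClosed

theorem joinedIn_region {A : Set V} {x y : V} (h : ConnIn G A x y) :
    JoinedIn (E.region A) (E.point x) (E.point y) := by
  obtain ⟨p, hp⟩ := h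
  induction p with
  | nil => exact JoinedIn.refl (Or.inl ⟨_, hp _ (by simp), rfl⟩)
  | @cons u v w huv p ih =>
    refine JoinedIn.trans ?_ (ih fun z hz ↦ hp z (by simp [hz]))
    obtain ⟨γ, -, hγ⟩ := E.isArc_edge u v huv
    refine ⟨γ, fun t ↦ Or.inr ?_⟩
    simp only [Set.mem_iUnion]
    refine ⟨s(u, v), ⟨huv, fun x hx ↦ ?_⟩, hγ ▸ ⟨t, rfl⟩⟩
    rcases Sym2.mem_iff.1 hx with rfl | rfl
    · exact hp _ (by simp)
    · exact hp _ (by simp)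

theorem not_mem_region {A : Set V} {v : V} (h : v ∉ A) : E.point v ∉ E.region A := by
  have := E.disjoint_region (Set.disjoint_singleton_left.2 h)
  exact Set.disjoint_left.1 this (Or.inl ⟨v, rfl, rfl⟩)

end PlanarEmbedding

/-- The face `F` is the third hub of a `K₃,₃`: it is open and path connected, misses the drawing and
has every `w i` on its boundary, so it reaches `w i` through a ball small enough to avoid the sets
belonging to the other indices. Connections sharing a hub or a target may overlap, so nothing is
required of two balls. -/
theorem IsOuterplanar.noTheta {V : Type*} [Finite V] {G : SimpleGraph V}
    (h : IsOuterplanar G) : NoTheta G := by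
  obtain ⟨E, F, ⟨⟨z₀, hz₀, hF⟩, -⟩, hfr⟩ := h
  intro p q w S T hS hT hST
  have hopen : IsOpen E.supportᶜ := by
    rw [E.support_eq_region]
    exact (E.isClosed_region _).isOpen_compl
  have hFo : IsOpen F := hF ▸ hopen.connectedComponentIn
  have hFs : Disjoint F E.support := by
    rw [hF, ← Set.subset_compl_iff_disjoint_right]
    exact connectedComponentIn_subset _ _
  have hFc : IsPathConnected F := by
    rw [← hFo.isConnected_iff_isPathConnected, hF]
    exact isConnected_connectedComponentIn_iff.2 hz₀
  have hball : ∀ i, ∃ δ > 0, ∀ j ≠ i,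
      Disjoint (Metric.ball (E.point (w i)) δ) (E.region (S j) ∪ E.region (T j)) := by
    intro i
    have hcl : IsClosed (⋃ j ∈ {j | j ≠ i}, (E.region (S j) ∪ E.region (T j))) :=
      Set.Finite.isClosed_biUnion (Set.toFinite _) fun j _ ↦
        (E.isClosed_region _).union (E.isClosed_region _)
    have hmem : E.point (w i) ∈ (⋃ j ∈ {j | j ≠ i}, (E.region (S j) ∪ E.region (T j)))ᶜ := by
      simp only [Set.mem_compl_iff, Set.mem_iUnion, not_exists, Set.mem_ofPred_eq]
      rintro j hj (h | h)
      · exact E.not_mem_region (Set.disjoint_right.1 (hST j i hj) (hT i).right_mem) h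
      · exact E.not_mem_region (Set.disjoint_left.1 (hST i j hj.symm) (hS i).right_mem) h
    obtain ⟨δ, hδ, hsub⟩ := Metric.isOpen_iff.1 hcl.isOpen_compl _ hmem
    refine ⟨δ, hδ, fun j hj ↦ ?_⟩
    rw [← Set.subset_compl_iff_disjoint_right]
    refine hsub.trans (Set.compl_subset_compl.2 ?_)
    exact Set.subset_biUnion_of_mem (u := fun j ↦ E.region (S j) ∪ E.region (T j)) hj
  choose δ hδ hball using hball
  have hz : ∀ i, ∃ z ∈ F, z ∈ Metric.ball (E.point (w i)) (δ i) := by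
    intro i
    obtain ⟨z, hz, hd⟩ := Metric.mem_closure_iff.1 (frontier_subset_closure (hfr (w i))) _ (hδ i)
    exact ⟨z, hz, by rwa [Metric.mem_ball, dist_comm]⟩
  choose z hzF hzb using hz
  have hhub : ∀ i, JoinedIn (F ∪ Metric.ball (E.point (w i)) (δ i)) (z 0) (E.point (w i)) := by
    intro i
    refine ((hFc.joinedIn _ (hzF 0) _ (hzF i)).mono Set.subset_union_left).trans ?_
    refine JoinedIn.mono ?_ Set.subset_union_right
    exact ((convex_ball _ _).isPathConnected ⟨_, hzb i⟩).joinedIn _ (hzb i) _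
      (Metric.mem_ball_self (hδ i))
  let R : Fin 3 → Fin 3 → Set ℂ := ![fun j ↦ E.region (S j), fun j ↦ E.region (T j),
    fun j ↦ F ∪ Metric.ball (E.point (w j)) (δ j)]
  have h02 : ∀ j j', j ≠ j' → Disjoint (R 0 j) (R 2 j') := fun j j' hj ↦
    Disjoint.symm <| (hFs.mono_right (E.region_subset_support _)).sup_left
      ((hball j' j hj).mono_right Set.subset_union_left)
  have h12 : ∀ j j', j ≠ j' → Disjoint (R 1 j) (R 2 j') := fun j j' hj ↦
    Disjoint.symm <| (hFs.mono_right (E.region_subset_support _)).sup_left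
      ((hball j' j hj).mono_right Set.subset_union_right)
  have h01 : ∀ j j', j ≠ j' → Disjoint (R 0 j) (R 1 j') := fun j j' hj ↦
    E.disjoint_region (hST j j' hj)
  refine not_joinedIn_of_disjoint (a := ![E.point p, E.point q, z 0])
    (b := fun i ↦ E.point (w i)) (S := R) ?_ ?_
  · intro i j
    fin_cases i
    · exact E.joinedIn_region (hS j)
    · exact E.joinedIn_region (hT j)
    · exact hhub j
  · intro i i' j j' hi hj
    fin_cases i <;> fin_cases i'
    · exact (hi rfl).elim
    · exact h01 j j' hj
    · exact h02 j j' hj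
    · exact (h01 j' j hj.symm).symm
    · exact (hi rfl).elim
    · exact h12 j j' hj
    · exact (h02 j' j hj.symm).symm
    · exact (h12 j' j hj.symm).symm
    · exact (hi rfl).elim

end ToneColoring

/-! ### Lassos and their longest tails. -/

namespace ToneColoring

open List

/-- The list `l` is the list of vertices of a path in `G`. -/
def PathList {V : Type*} (G : SimpleGraph V) (l : List V) : Prop :=
  l.IsChain G.Adj ∧ l.Nodup

/-- A path `B ++ a :: (Y ++ [d])` together with an edge from its end `d` to an inner vertex `a`
that is not the predecessor of `d`. -/
structure Lasso {V : Type*} (G : SimpleGraph V) (B : List V) (a : V) (Y : List V) (d : V) :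
    Prop where
  pathList : PathList G (B ++ a :: (Y ++ [d]))
  ne_nil : Y ≠ []
  adj : G.Adj d a

section PathList

variable {V : Type*} {G : SimpleGraph V} {l l₁ l₂ : List V} {x y : V}

theorem PathList.infix (h : PathList G l) (h' : l₁ <:+: l) : PathList G l₁ :=
  ⟨h.1.infix h', h.2.sublist h'.sublist⟩

theorem PathList.prefix (h : PathList G l) (h' : l₁ <+: l) : PathList G l₁ := h.infix h'.isInfix

theorem PathList.connIn (h : PathList G l) (hx : x ∈ l) (hy : y ∈ l) :
    ConnIn G {v | v ∈ l} x y := by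
  have key : ∀ (l : List V), l.IsChain G.Adj → ∀ x ∈ l.head?, ∀ y ∈ l,
      ConnIn G {v | v ∈ l} x y := by
    intro l hl
    induction l with
    | nil => simp
    | cons u l ih =>
      intro x hx y hy
      obtain rfl : u = x := by simpa using hx
      cases l with
      | nil =>
        obtain rfl : y = u := by simpa using hy
        exact .refl hy
      | cons v l =>
        rcases List.mem_cons.1 hy with rfl | hy
        · exact .refl (by simp)
        · have := ih hl.of_cons v (by simp) y hy
          exact (ConnIn.of_adj (hl.rel) (by simp) (by simp)).trans
            (this.mono fun z hz ↦ List.mem_cons_of_mem _ hz)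
  cases l with
  | nil => simp at hx
  | cons u l => exact (key _ h.1 u (by simp) x hx).symm.trans (key _ h.1 u (by simp) y hy)

theorem PathList.length_le [Fintype V] (h : PathList G l) : l.length ≤ Fintype.card V :=
  h.2.length_le_card

/-- Every path can be prolonged within the complement of `D` until its end has no neighbour that
is neither in `D` nor on the path. -/
theorem PathList.exists_maximal [Fintype V] (D : Set V) (P : List V) (y : V)
    (h : PathList G (P ++ [y])) (hy : y ∉ D) : ∃ E : List V, PathList G (P ++ y :: E) ∧
      (∀ e ∈ y :: E, e ∉ D) ∧
      ∀ l ∈ (y :: E).getLast?, ∀ z, G.Adj l z → z ∈ P ++ y :: E ∨ z ∈ D := by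
  induction hn : Fintype.card V - P.length using Nat.strong_induction_on generalizing P y with
  | _ n ih =>
    by_cases hz : ∃ z, G.Adj y z ∧ z ∉ P ++ [y] ∧ z ∉ D
    · obtain ⟨z, hyz, hzP, hzD⟩ := hz
      have hP := h.length_le
      have hPz : PathList G (P ++ [y] ++ [z]) := by
        refine ⟨?_, ?_⟩
        · refine h.1.append (by simp) ?_
          simp only [getLast?_append, getLast?_singleton, head?_cons]
          simpa using hyz
        · rw [List.nodup_append]
          exact ⟨h.2, by simp, by rintro a ha b hb rfl; simp at hb; exact hzP (hb ▸ ha)⟩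
      simp only [length_append, length_singleton] at hP
      obtain ⟨E, hE, hED, hEl⟩ := ih _ (by simp only [length_append, length_singleton]; omega)
        (P ++ [y]) z hPz hzD rfl
      refine ⟨z :: E, by simpa using hE, ?_, ?_⟩
      · simpa [hy] using hED
      · intro l hl z' hz'
        have := hEl l (by simpa using hl) z' hz'
        simpa [or_assoc] using this
    · push Not at hz
      refine ⟨[], h, by simpa using hy, ?_⟩
      intro l hl z hlz
      obtain rfl : y = l := by simpa using hl
      by_cases hzP : z ∈ P ++ [y]
      · exact .inl hzP
      · exact .inr (hz z hlz hzP)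

end PathList

section Lasso

variable {V : Type*} {G : SimpleGraph V}

/-- The end of a maximal path has a neighbour besides its predecessor, and by maximality that
neighbour lies on the path. -/
theorem exists_lasso [Fintype V] (hmin : ∀ v u, G.Adj v u → ∃ z, G.Adj v z ∧ z ≠ u) {u v : V}
    (huv : G.Adj u v) : ∃ B a Y d, Lasso G B a Y d := by
  obtain ⟨E, hE, -, hEl⟩ := PathList.exists_maximal (G := G) ∅ [u] v
    ⟨by simpa using huv, by simpa using huv.ne⟩ (by simp)
  obtain ⟨R, p, l, hR⟩ : ∃ R p l, [u] ++ v :: E = R ++ [p, l] := by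
    obtain ⟨E', l, hE'⟩ := (List.eq_nil_or_concat (v :: E)).resolve_left (by simp)
    obtain ⟨R, p, hR⟩ := (List.eq_nil_or_concat (u :: E')).resolve_left (by simp)
    refine ⟨R, p, l, ?_⟩
    calc [u] ++ v :: E = (u :: E') ++ [l] := by rw [hE']; simp
      _ = _ := by rw [hR]; simp
  have hl : l ∈ (v :: E).getLast? := by
    have : ([u] ++ v :: E).getLast? = some l := by rw [hR]; simp
    simpa using this
  rw [hR] at hE hEl
  have hlp : G.Adj l p := by
    have := (hE.infix (l₁ := [p, l]) ⟨R, [], by simp⟩).1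
    exact (by simpa using this : G.Adj p l).symm
  obtain ⟨z, hlz, hzp⟩ := hmin l p hlp
  have hz : z ∈ R := by
    have := hEl l hl z hlz
    simp only [mem_append, mem_cons, not_mem_nil, or_false, Set.mem_empty_iff_false] at this
    rcases this with h | h | h
    · exact h
    · exact (hzp h).elim
    · exact (hlz.ne h.symm).elim
  obtain ⟨L, Y, rfl⟩ := List.append_of_mem hz
  exact ⟨L, z, Y ++ [p], l, by simpa using hE, by simp, hlz⟩

theorem exists_max_lasso [Fintype V] (hmin : ∀ v u, G.Adj v u → ∃ z, G.Adj v z ∧ z ≠ u) {u v : V}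
    (huv : G.Adj u v) : ∃ B a Y d, Lasso G B a Y d ∧
      ∀ B' a' Y' d', Lasso G B' a' Y' d' → B'.length ≤ B.length := by
  by_contra! hcon
  have key : ∀ n : ℕ, ∃ B a Y d, Lasso G B a Y d ∧ n ≤ B.length := by
    intro n
    induction n with
    | zero =>
      obtain ⟨B, a, Y, d, h⟩ := exists_lasso hmin huv
      exact ⟨B, a, Y, d, h, Nat.zero_le _⟩
    | succ n ih =>
      obtain ⟨B, a, Y, d, h, hn⟩ := ih
      obtain ⟨B', a', Y', d', h', hn'⟩ := hcon B a Y d h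
      exact ⟨B', a', Y', d', h', by omega⟩
  obtain ⟨B, a, Y, d, h, hn⟩ := key (Fintype.card V + 1)
  have := h.pathList.length_le
  simp only [length_append, length_cons] at this
  omega

end Lasso

end ToneColoring

/-! ### Consequences of maximality of the tail. -/

namespace ToneColoring

open List

section Lasso

variable {V : Type*} {G : SimpleGraph V} {B X X₁ X₂ : List V} {a b x y : V}

/-- The cycle closed by a lasso of maximal tail length has no chord that avoids the vertex `a`. -/
theorem notMem_of_max (hmax : ∀ B' a' Y' d', Lasso G B' a' Y' d' → B'.length ≤ B.length)
    (h : PathList G (B ++ a :: (X₁ ++ x :: X₂))) (hxy : G.Adj x y)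
    (hpred : (a :: X₁).getLast? ≠ some y) (hsucc : (X₂ ++ [a]).head? ≠ some y) :
    y ∉ X₁ ++ x :: X₂ := by
  intro hy
  simp only [mem_append, mem_cons] at hy
  rcases hy with hy | rfl | hy
  · obtain ⟨C₁, C₂, rfl⟩ := List.append_of_mem hy
    have hC : C₂ ≠ [] := by
      rintro rfl
      simp [getLast?_cons] at hpred
    have := hmax (B ++ a :: C₁) y C₂ x ⟨h.prefix ⟨X₂, by simp⟩, hC, hxy⟩
    simp at this
  · exact hxy.ne rfl
  · obtain ⟨C₁, C₂, rfl⟩ := List.append_of_mem hy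
    have hC : C₁ ≠ [] := by
      rintro rfl
      simp at hsucc
    have := hmax (B ++ a :: X₁) x C₁ y ⟨h.prefix ⟨C₂, by simp⟩, hC, hxy.symm⟩
    simp at this

/-- The walk leaves the cycle at `x` through `y` and is prolonged as far as possible without
entering `X₂`. Its end `l` has a second neighbour `z`. If `z` is in the tail or equal to `a`, one of
the alternatives holds; for every other position of `z` a lasso with a longer tail appears. -/
theorem exists_escape [Fintype V] (hmin : ∀ v u, G.Adj v u → ∃ z, G.Adj v z ∧ z ≠ u)
    (hmax : ∀ B' a' Y' d', Lasso G B' a' Y' d' → B'.length ≤ B.length)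
    (h : PathList G (B ++ a :: (X₁ ++ x :: X₂))) (hxy : G.Adj x y)
    (hy : y ∉ a :: (X₁ ++ x :: X₂)) :
    (∃ z ∈ B, ConnIn G {v | v ∉ a :: (X₁ ++ x :: X₂)} y z) ∨
      ∃ l, l ∉ B ++ a :: (X₁ ++ x :: X₂) ∧ G.Adj l a := by
  by_cases hyB : y ∈ B
  · exact .inl ⟨y, hyB, .refl hy⟩
  have hP : PathList G ((B ++ a :: (X₁ ++ [x])) ++ [y]) := by
    have hpre : PathList G (B ++ a :: (X₁ ++ [x])) := h.prefix ⟨X₂, by simp⟩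
    refine ⟨hpre.1.append (by simp) ?_, ?_⟩
    · have : (B ++ a :: (X₁ ++ [x])).getLast? = some x := by simp [getLast?_cons]
      rw [this]
      simpa using hxy
    · rw [List.nodup_append]
      refine ⟨hpre.2, by simp, ?_⟩
      grind
  obtain ⟨E, hE, hED, hEl⟩ := hP.exists_maximal {v | v ∈ X₂} _ y (by grind)
  obtain ⟨R, p, l, hR⟩ : ∃ R p l, x :: y :: E = R ++ [p, l] := by
    obtain ⟨E', l, hE'⟩ := (List.eq_nil_or_concat (y :: E)).resolve_left (by simp)
    obtain ⟨R, p, hR⟩ := (List.eq_nil_or_concat (x :: E')).resolve_left (by simp)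
    refine ⟨R, p, l, ?_⟩
    calc x :: y :: E = (x :: E') ++ [l] := by rw [hE']; simp
      _ = _ := by rw [hR]; simp
  have hl : l ∈ (y :: E).getLast? := by
    have : (x :: y :: E).getLast? = some l := by rw [hR]; simp
    simpa using this
  have hEeq : B ++ a :: (X₁ ++ [x]) ++ y :: E = B ++ a :: (X₁ ++ (R ++ [p, l])) := by
    rw [← hR]; simp
  have hlE : l ∈ y :: E := List.mem_of_getLast? hl
  have hlX : l ∉ B ++ a :: (X₁ ++ x :: X₂) := by
    have h1 := hE.2
    have h2 := hED l hlE
    rw [List.nodup_append] at h1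
    have h3 := fun v hv ↦ h1.2.2 v hv l hlE
    simp only [Set.mem_ofPred_eq] at h2
    grind
  have hyE : ∀ v ∈ y :: E, v ∉ a :: (X₁ ++ x :: X₂) := by
    intro v hv
    have h1 := hE.2
    have h2 := hED v hv
    rw [List.nodup_append] at h1
    have h3 := fun u hu ↦ h1.2.2 u hu v hv
    simp only [Set.mem_ofPred_eq] at h2
    grind
  have hlp : G.Adj l p := by
    have := (hE.infix (l₁ := [p, l]) ⟨B ++ a :: (X₁ ++ R), [], by rw [hEeq]; simp⟩).1
    exact (by simpa using this : G.Adj p l).symm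
  obtain ⟨z, hlz, hzp⟩ := hmin l p hlp
  have hz := hEl l hl z hlz
  have hE' := hE
  rw [hEeq] at hz hE'
  have hz' : z ∈ B ∨ z = a ∨ z ∈ X₁ ∨ z ∈ R ∨ z ∈ X₂ := by
    have := hlz.ne
    simp only [mem_append, mem_cons, not_mem_nil, or_false, Set.mem_ofPred_eq] at hz
    grind
  rcases hz' with hz | rfl | hz | hz | hz
  · refine .inl ⟨z, hz, ?_⟩
    have hyl : ConnIn G {v | v ∈ y :: E} y l :=
      (hE.infix (l₁ := y :: E) ⟨B ++ a :: (X₁ ++ [x]), [], by simp⟩).connIn (by simp) hlE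
    refine (hyl.mono hyE).trans (.of_adj hlz (hyE l hlE) ?_)
    have := h.2
    rw [List.nodup_append] at this
    exact fun hza ↦ this.2.2 z hz z hza rfl
  · exact .inr ⟨l, hlX, hlz⟩
  · obtain ⟨C₁, C₂, rfl⟩ := List.append_of_mem hz
    have := hmax (B ++ a :: C₁) z (C₂ ++ R ++ [p]) l ⟨by simpa using hE', by simp, hlz⟩
    simp at this
  · obtain ⟨C₁, C₂, rfl⟩ := List.append_of_mem hz
    have := hmax (B ++ a :: (X₁ ++ C₁)) z (C₂ ++ [p]) l ⟨by simpa using hE', by simp, hlz⟩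
    simp at this
  -- Here the new path returns to the old cycle beyond `x`. Following the old cycle backwards from
  -- `z` to the successor `c` of `x` closes a cycle at `x`, whose tail `B ++ a :: X₁` is longer than
  -- `B`.
  · obtain ⟨C₁, C₂, rfl⟩ := List.append_of_mem hz
    obtain ⟨C, c, hC⟩ := (List.eq_nil_or_concat (y :: E ++ z :: C₁.reverse)).resolve_left (by simp)
    rw [List.concat_eq_append] at hC
    have hC0 : C ≠ [] := by
      rintro rfl
      simp at hC
    have hxc : G.Adj c x := by
      have h1 : ((x :: (C₁ ++ [z])).reverse).IsChain G.Adj := by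
        rw [List.isChain_reverse]
        refine (h.1.infix (l₁ := x :: (C₁ ++ [z])) ⟨B ++ a :: X₁, C₂, by simp⟩).imp ?_
        exact fun _ _ ↦ G.adj_symm
      have h2 : (x :: (C₁ ++ [z])).reverse = z :: C₁.reverse ++ [x] := by simp
      rw [h2] at h1
      refine (List.isChain_append.1 h1).2.2 c ?_ x (by simp)
      have := congrArg List.getLast? hC
      rw [List.getLast?_append_of_ne_nil _ (by simp)] at this
      simp [this]
    have := hmax (B ++ a :: X₁) x C c ⟨?_, hC0, hxc⟩
    · simp at this
    · rw [← hC]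
      have h2 : B ++ a :: X₁ ++ x :: (y :: E ++ z :: C₁.reverse) =
          (B ++ a :: (X₁ ++ [x]) ++ y :: E) ++ (C₁ ++ [z]).reverse := by simp
      rw [h2]
      have hX₂ : PathList G (C₁ ++ [z]) := h.infix ⟨B ++ a :: (X₁ ++ [x]), C₂, by simp⟩
      refine ⟨hE.1.append ?_ ?_, ?_⟩
      · rw [List.isChain_reverse]
        exact hX₂.1.imp fun _ _ ↦ G.adj_symm
      · intro u hu v hv
        rw [List.getLast?_append_of_ne_nil _ (by simp)] at hu
        obtain rfl := Option.mem_unique hl hu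
        obtain rfl : z = v := by simpa using hv
        exact hlz
      · rw [List.nodup_append]
        refine ⟨hE.2, List.nodup_reverse.2 hX₂.2, ?_⟩
        rintro u hu v hv rfl
        have hv' : u ∈ C₁ ++ z :: C₂ := by
          simp only [mem_reverse, mem_append, mem_cons, not_mem_nil, or_false] at hv ⊢
          tauto
        rcases List.mem_append.1 hu with hu | hu
        · have := h.2
          rw [show B ++ a :: (X₁ ++ x :: (C₁ ++ z :: C₂)) =
            B ++ a :: (X₁ ++ [x]) ++ (C₁ ++ z :: C₂) by simp, List.nodup_append] at this
          exact this.2.2 u hu u hv' rfl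
        · exact hED u hu hv'

end Lasso

end ToneColoring

/-! ### Ears, and third neighbours of the vertices of the cycle. -/

namespace ToneColoring

open List

/-- A path `u :: (W ++ [v])` with adjacent ends all of whose inner vertices have degree two. -/
structure EarList {V : Type*} (G : SimpleGraph V) (u : V) (W : List V) (v : V) : Prop where
  pathList : PathList G (u :: (W ++ [v]))
  ne_nil : W ≠ []
  adj : G.Adj v u
  eq_or_eq : ∀ W₁ w W₂, W = W₁ ++ w :: W₂ → ∀ y, G.Adj w y →
    (u :: W₁).getLast? = some y ∨ (W₂ ++ [v]).head? = some y

section Structure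

variable {V : Type*} {G : SimpleGraph V} {B X X₁ X₂ M : List V} {a b c d x y : V}

/-- The degree bound at `a`, already adjacent to `b`, `c` and `d`, excludes both a chord ending in
`a` and the second alternative of `exists_escape`. The walk from `y` therefore reaches the tail, and
follows it to `b`. -/
theorem exists_escape_of_third [Fintype V]
    (hmin : ∀ v u, G.Adj v u → ∃ z, G.Adj v z ∧ z ≠ u)
    (hdeg : ∀ v x y z w, G.Adj v x → G.Adj v y → G.Adj v z → G.Adj v w →
      [x, y, z, w].Nodup → False)
    (hmax : ∀ B' a' Y' d', Lasso G B' a' Y' d' → B'.length ≤ (B ++ [b]).length)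
    (hlasso : Lasso G (B ++ [b]) a (c :: M) d) (hX : c :: M ++ [d] = X₁ ++ x :: X₂)
    (hxy : G.Adj x y) (hpred : (a :: X₁).getLast? ≠ some y)
    (hsucc : (X₂ ++ [a]).head? ≠ some y) :
    y ∉ a :: (c :: M ++ [d]) ∧ ConnIn G {v | v ∉ a :: (c :: M ++ [d])} y b := by
  have h := hlasso.pathList
  have hab : G.Adj a b := by
    have := (h.infix (l₁ := [b, a]) ⟨B, c :: M ++ [d], by simp⟩).1
    exact (by simpa using this : G.Adj b a).symm
  have hac : G.Adj a c := by
    have := (h.infix (l₁ := [a, c]) ⟨B ++ [b], M ++ [d], by simp⟩).1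
    simpa using this
  have hnd := h.2
  have hyX : y ∉ a :: (c :: M ++ [d]) := by
    have h1 : y ∉ c :: M ++ [d] := by
      rw [hX] at h ⊢
      exact notMem_of_max hmax h hxy hpred hsucc
    intro hy
    obtain rfl : y = a := by
      rcases List.mem_cons.1 hy with rfl | hy
      · rfl
      · exact (h1 hy).elim
    obtain ⟨x₁, X₁, rfl⟩ := List.exists_cons_of_ne_nil (l := X₁) (by rintro rfl; simp at hpred)
    obtain ⟨X₂, x₂, rfl⟩ := (List.eq_nil_or_concat X₂).resolve_left (by rintro rfl; simp at hsucc)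
    rw [List.concat_eq_append] at hX
    have hc : c = x₁ := by simpa using congrArg List.head? hX
    have hd : d = x₂ := by
      have := congrArg List.getLast? hX
      simpa [getLast?_cons] using this
    subst hc hd
    refine hdeg y b c x d hab hac hxy.symm hlasso.adj.symm ?_
    rw [hX] at hnd
    refine hnd.sublist ?_
    have h1 : [b] <+ B ++ [b] := List.sublist_append_right _ _
    have h2 : [c, x, d] <+ y :: (c :: X₁ ++ x :: (X₂ ++ [d])) := by
      refine List.Sublist.cons _ (List.Sublist.cons_cons _ ?_)
      refine (List.Sublist.cons_cons x ?_).trans (List.sublist_append_right _ _)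
      exact List.sublist_append_right _ _
    exact h1.append h2
  refine ⟨hyX, ?_⟩
  have hb : ∀ z ∈ B ++ [b], z ∉ a :: (c :: M ++ [d]) := by
    rw [List.nodup_append] at hnd
    exact fun z hz hz' ↦ hnd.2.2 z hz z hz' rfl
  have hesc := exists_escape (G := G) (B := B ++ [b]) (X₁ := X₁) (X₂ := X₂) (a := a) (x := x)
    (y := y) hmin hmax (by rw [← hX]; exact h) hxy (by rw [← hX]; exact hyX)
  rw [← hX] at hesc
  rcases hesc with ⟨z, hz, hyz⟩ | ⟨l, hl, hla⟩
  · refine hyz.trans ?_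
    exact ((h.prefix (l₁ := B ++ [b]) ⟨_, rfl⟩).connIn hz (by simp)).mono hb
  · refine (hdeg a b c d l hab hac hlasso.adj.symm hla.symm ?_).elim
    have : [b, c, d].Nodup := by
      refine hnd.sublist ?_
      have h1 : [b] <+ B ++ [b] := List.sublist_append_right _ _
      have h2 : [c, d] <+ a :: (c :: M ++ [d]) :=
        List.Sublist.cons _ (List.Sublist.cons_cons _ (List.sublist_append_right _ _))
      exact h1.append h2
    grind

/-- If the closing vertex of a lasso of maximal tail length is the first vertex of its path, then
all vertices of its cycle have degree two. -/
theorem earList_of_max_nil (hmax : ∀ B' a' Y' d', Lasso G B' a' Y' d' → B'.length ≤ 0)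
    (hlasso : Lasso G [] a X d) : EarList G a X d := by
  have h := hlasso.pathList
  refine ⟨h, hlasso.ne_nil, hlasso.adj, ?_⟩
  rintro X₁ x X₂ rfl y hxy
  by_contra! hcon
  obtain ⟨hpred, hsucc⟩ := hcon
  -- The cycle is opened at another place: a chord from `a` to `x` gives a lasso closing at `x` with
  -- nonempty tail `X₁`, while a neighbour `y` off the cycle gives a lasso with tail `[y]`.
  have hrot : PathList G ((X₁ ++ x :: X₂ ++ [d]) ++ [a]) := by
    refine ⟨(h.infix (l₁ := X₁ ++ x :: X₂ ++ [d]) ⟨[a], [], by simp⟩).1.append (by simp) ?_, ?_⟩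
    · intro u hu v hv
      rw [List.getLast?_append_of_ne_nil _ (by simp)] at hu
      obtain rfl : d = u := by simpa using hu
      obtain rfl : a = v := by simpa using hv
      exact hlasso.adj
    · have := h.2
      rw [List.nodup_append_comm]
      simpa using this
  have hyX : y ∉ X₁ ++ x :: (X₂ ++ [d]) := by
    refine notMem_of_max (B := []) (a := a) hmax (by simpa using h) hxy hpred ?_
    simpa using hsucc
  by_cases hya : y = a
  · subst hya
    have hX₁ : X₁ ≠ [] := by
      rintro rfl
      simp at hpred
    have := hmax X₁ x (X₂ ++ [d]) y ⟨by simpa using hrot, by simp, hxy.symm⟩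
    exact hX₁ (List.length_eq_zero_iff.1 (by omega))
  · have hrot' : PathList G ((x :: X₂ ++ [d]) ++ (a :: X₁)) := by
      refine ⟨(h.infix (l₁ := x :: X₂ ++ [d]) ⟨a :: X₁, [], by simp⟩).1.append
        (h.prefix (l₁ := a :: X₁) ⟨x :: X₂ ++ [d], by simp⟩).1 ?_, ?_⟩
      · intro u hu v hv
        rw [List.getLast?_append_of_ne_nil _ (by simp)] at hu
        obtain rfl : d = u := by simpa using hu
        obtain rfl : a = v := by simpa using hv
        exact hlasso.adj
      · have := h.2
        rw [List.nodup_append_comm]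
        simpa using this
    obtain ⟨Y, e, hY⟩ := (List.eq_nil_or_concat (a :: X₁)).resolve_left (by simp)
    rw [List.concat_eq_append] at hY
    have hex : G.Adj e x := by
      have h1 : PathList G ((a :: X₁) ++ [x]) := h.prefix ⟨X₂ ++ [d], by simp⟩
      refine (List.isChain_append.1 h1.1).2.2 e ?_ x (by simp)
      rw [hY]
      simp
    have := hmax [y] x (X₂ ++ [d] ++ Y) e ⟨?_, by simp, hex⟩
    · simp at this
    · have h2 : [y] ++ x :: (X₂ ++ [d] ++ Y ++ [e]) = y :: ((x :: X₂ ++ [d]) ++ (a :: X₁)) := by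
        rw [hY]; simp
      rw [h2]
      refine ⟨?_, List.nodup_cons.2 ⟨?_, hrot'.2⟩⟩
      · refine hrot'.1.cons fun z hz ↦ ?_
        obtain rfl : x = z := by simpa using hz
        exact hxy.symm
      · simp only [mem_append, mem_cons, not_mem_nil, or_false] at hyX ⊢
        tauto

/-- From `b` one of two distinct vertices can be reached without passing the other. -/
theorem ConnIn.diff_or_diff {A : Set V} {x y b : V} (hx : ConnIn G A x b)
    (hy : ConnIn G A y b) (hxy : x ≠ y) : ConnIn G (A \ {x}) y b ∨ ConnIn G (A \ {y}) x b := by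
  classical
  obtain ⟨p, hp⟩ := hx.symm
  by_cases hyp : y ∈ p.toPath.1.support
  · refine .inl (ConnIn.symm ⟨p.toPath.1.takeUntil y hyp, fun z hz ↦ ⟨hp z ?_, ?_⟩⟩)
    · exact p.support_toPath_subset_support (SimpleGraph.Walk.support_takeUntil_subset_support _ _ hz)
    · rintro rfl
      exact SimpleGraph.Walk.endpoint_notMem_support_takeUntil p.toPath.2 hyp hxy hz
  · refine .inr (ConnIn.symm ⟨p.toPath.1, fun z hz ↦ ⟨hp z (p.support_toPath_subset_support hz), ?_⟩⟩)
    rintro rfl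
    exact hyp hz

theorem NoTheta.elim (hG : NoTheta G) {p q w₀ w₁ w₂ : V} {S₀ S₁ S₂ T₀ T₁ T₂ : Set V}
    (hS₀ : ConnIn G S₀ p w₀) (hS₁ : ConnIn G S₁ p w₁) (hS₂ : ConnIn G S₂ p w₂)
    (hT₀ : ConnIn G T₀ q w₀) (hT₁ : ConnIn G T₁ q w₁) (hT₂ : ConnIn G T₂ q w₂)
    (h₀₁ : ∀ v ∈ S₀, v ∉ T₁) (h₀₂ : ∀ v ∈ S₀, v ∉ T₂) (h₁₀ : ∀ v ∈ S₁, v ∉ T₀)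
    (h₁₂ : ∀ v ∈ S₁, v ∉ T₂) (h₂₀ : ∀ v ∈ S₂, v ∉ T₀) (h₂₁ : ∀ v ∈ S₂, v ∉ T₁) : False := by
  refine hG p q ![w₀, w₁, w₂] ![S₀, S₁, S₂] ![T₀, T₁, T₂] ?_ ?_ ?_
  · intro i
    fin_cases i <;> assumption
  · intro i
    fin_cases i <;> assumption
  · intro i j hij
    rw [Set.disjoint_left]
    fin_cases i <;> fin_cases j <;> first | exact (hij rfl).elim | skip
    all_goals assumption

/-- The hubs are `b` and `c`, the targets `a`, `d` and `y`. From `c` all three are adjacent; from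
`b` one gets to `a` directly, to `d` through `y'` without meeting `y`, and to `y` inside `Z`. -/
theorem NoTheta.not_triangle (hG : NoTheta G) {Z : Set V} {a c d b y y' : V}
    (hac : G.Adj a c) (hcd : G.Adj c d) (hda : G.Adj d a) (ha : a ∉ Z) (hc : c ∉ Z) (hd : d ∉ Z)
    (hab : G.Adj a b) (hcy : G.Adj c y) (hdy : G.Adj d y') (hby : b ≠ y)
    (hy : ConnIn G Z y b) (hy' : ConnIn G (Z \ {y}) y' b) : False := by
  have hbZ : b ∈ Z := hy.right_mem
  have hyZ : y ∈ Z := hy.left_mem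
  refine hG.elim (p := b) (q := c) (w₀ := a) (w₁ := d) (w₂ := y) (S₀ := {a, b})
    (S₁ := insert d (Z \ {y})) (S₂ := Z) (T₀ := {c, a}) (T₁ := {c, d}) (T₂ := {c, y})
    (.of_adj hab.symm (by simp) (by simp)) ?_ hy.symm (.of_adj hac.symm (by simp) (by simp))
    (.of_adj hcd (by simp) (by simp)) (.of_adj hcy (by simp) (by simp)) ?_ ?_ ?_ ?_ ?_ ?_
  · exact (hy'.symm.mono (Set.subset_insert _ _)).trans
      (.of_adj hdy.symm (.inr hy'.left_mem) (.inl rfl))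
  · have := hac.ne; have := hda.ne
    rintro v (rfl | rfl) (rfl | rfl) <;> simp_all
  · have := hac.ne
    rintro v (rfl | rfl) (rfl | rfl) <;> simp_all
  · have := hcd.ne; have := hda.ne
    rintro v (rfl | ⟨h1, h2⟩) (rfl | rfl) <;> simp_all
  · have := hcd.ne
    rintro v (rfl | ⟨h1, h2⟩) (rfl | rfl) <;> simp_all
  · rintro v hv (rfl | rfl) <;> simp_all
  · rintro v hv (rfl | rfl) <;> simp_all

end Structure

end ToneColoring

/-! ### Existence of an ear. -/

namespace ToneColoring

open List

variable {V : Type*} {G : SimpleGraph V}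

theorem exists_third_of_not_earList {u v : V} {W : List V} (h : PathList G (u :: (W ++ [v])))
    (hW : W ≠ []) (huv : G.Adj v u) (hno : ¬ EarList G u W v) :
    ∃ W₁ w W₂ y, W = W₁ ++ w :: W₂ ∧ G.Adj w y ∧ (u :: W₁).getLast? ≠ some y ∧
      (W₂ ++ [v]).head? ≠ some y := by
  by_contra! hcon
  refine hno ⟨h, hW, huv, fun W₁ w W₂ hWeq y hwy ↦ ?_⟩
  by_contra! hor
  exact hor.2 (hcon W₁ w W₂ y hWeq hwy hor.1)

/-- On the cycle of a lasso with longest tail, a third neighbour at a vertex other than `a`, `c`,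
`d` gives a theta. So one of the two paths obtained by deleting the edge `d a` or `a c` from the
cycle is an ear, unless `c` and `d` both have third neighbours; in that case both have connections
to `b` off the cycle. -/
theorem exists_earList [Fintype V]
    (hmin : ∀ v u, G.Adj v u → ∃ z, G.Adj v z ∧ z ≠ u)
    (hdeg : ∀ v x y z w, G.Adj v x → G.Adj v y → G.Adj v z → G.Adj v w →
      [x, y, z, w].Nodup → False)
    (hK : ∀ u v x y, u ≠ v → G.Adj x y → G.Adj u x → G.Adj u y → G.Adj v x → G.Adj v y → False)
    (hG : NoTheta G) {s t : V} (hst : G.Adj s t) : ∃ u W v, EarList G u W v := by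
  obtain ⟨B, a, Y, d, hlasso, hmax⟩ := exists_max_lasso hmin hst
  obtain rfl | ⟨B, b, rfl⟩ := List.eq_nil_or_concat B
  · exact ⟨a, Y, d, earList_of_max_nil hmax hlasso⟩
  rw [List.concat_eq_append] at hlasso hmax
  obtain ⟨c, M, rfl⟩ := List.exists_cons_of_ne_nil hlasso.ne_nil
  have third := fun {X₁ X₂ x y} ↦ exists_escape_of_third (X₁ := X₁) (X₂ := X₂) (x := x) (y := y)
    hmin hdeg hmax hlasso
  have h := hlasso.pathList
  have hda := hlasso.adj
  have hab : G.Adj a b := by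
    have := (h.infix (l₁ := [b, a]) ⟨B, c :: M ++ [d], by simp⟩).1
    exact (by simpa using this : G.Adj b a).symm
  have hac : G.Adj a c := by
    have := (h.infix (l₁ := [a, c]) ⟨B ++ [b], M ++ [d], by simp⟩).1
    simpa using this
  have hcyc : PathList G (a :: (c :: M ++ [d])) := h.infix ⟨B ++ [b], [], by simp⟩
  have hb : b ∉ a :: (c :: M ++ [d]) := by
    have := h.2
    rw [List.nodup_append] at this
    exact fun hb ↦ this.2.2 b (by simp) b hb rfl
  -- The theta has hubs `a` and `x` and targets `c`, `d` and `b`: the two arcs of the cycle and the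
  -- escape from `x` through `y` to `b`.
  have inner : ∀ X₁ x X₂ y, c :: M ++ [d] = X₁ ++ x :: X₂ → X₁ ≠ [] → X₂ ≠ [] → G.Adj x y →
      (a :: X₁).getLast? ≠ some y → (X₂ ++ [a]).head? ≠ some y → False := by
    intro X₁ x X₂ y hX hX₁ hX₂ hxy hpred hsucc
    obtain ⟨hyX, hyb⟩ := third hX hxy hpred hsucc
    obtain ⟨c', X₁, rfl⟩ := List.exists_cons_of_ne_nil hX₁
    obtain ⟨X₂, d', rfl⟩ := (List.eq_nil_or_concat X₂).resolve_left hX₂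
    rw [List.concat_eq_append] at hX
    have hc : c = c' := by simpa using congrArg List.head? hX
    have hd : d = d' := by
      have := congrArg List.getLast? hX
      simpa [getLast?_cons] using this
    subst hc hd
    rw [hX] at hcyc hb hyX hyb
    have hnd := hcyc.2
    refine hG.elim (p := a) (q := x) (w₀ := c) (w₁ := d) (w₂ := b) (S₀ := {a, c}) (S₁ := {a, d})
      (S₂ := {a, b}) (T₀ := {v | v ∈ c :: X₁ ++ [x]}) (T₁ := {v | v ∈ x :: X₂ ++ [d]})
      (T₂ := insert x {v | v ∉ a :: (c :: X₁ ++ x :: (X₂ ++ [d]))})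
      (.of_adj hac (by simp) (by simp)) (.of_adj hda.symm (by simp) (by simp))
      (.of_adj hab (by simp) (by simp))
      ((hcyc.infix (l₁ := c :: X₁ ++ [x]) ⟨[a], X₂ ++ [d], by simp⟩).connIn (by simp) (by simp))
      ((hcyc.infix (l₁ := x :: X₂ ++ [d]) ⟨a :: c :: X₁, [], by simp⟩).connIn (by simp) (by simp))
      ((ConnIn.of_adj hxy (by simp) (.inr hyX)).trans (hyb.mono (Set.subset_insert _ _)))
      ?_ ?_ ?_ ?_ ?_ ?_
    all_goals
      clear hX third hX₁ hX₂ hpred hsucc hmin hdeg hK hmax hlasso h hcyc hyb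
      simp only [nodup_cons, List.nodup_append, mem_append, mem_cons, not_mem_nil, or_false,
        cons_append, Set.mem_insert_iff, Set.mem_singleton_iff, Set.mem_ofPred_eq] at hnd hb ⊢
      grind
  by_contra hno
  obtain ⟨X₁, x, X₂, y, hX, hxy, hpred, hsucc⟩ := exists_third_of_not_earList
    (u := a) (W := c :: M) (v := d) (by simpa using hcyc) (by simp) hda (fun h ↦ hno ⟨_, _, _, h⟩)
  have hrot : PathList G (c :: (M ++ [d] ++ [a])) := by
    refine ⟨(hcyc.infix (l₁ := c :: (M ++ [d])) ⟨[a], [], by simp⟩).1.append (by simp) ?_, ?_⟩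
    · intro u hu v hv
      obtain rfl : d = u := by
        have : (c :: M ++ [d]).getLast? = some u := hu
        rw [List.getLast?_append_of_ne_nil _ (by simp)] at this
        simpa using this
      obtain rfl : a = v := by simpa using hv
      exact hda
    · have := hcyc.2
      rw [show c :: (M ++ [d] ++ [a]) = (c :: M ++ [d]) ++ [a] by simp, List.nodup_append_comm]
      simpa using this
  obtain ⟨X₁', x', X₂', y', hX', hxy', hpred', hsucc'⟩ := exists_third_of_not_earList
    (u := c) (W := M ++ [d]) (v := a) hrot (by simp) hac (fun h ↦ hno ⟨_, _, _, h⟩)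
  have hX₁ : X₁ = [] := by
    by_contra hne
    exact inner X₁ x (X₂ ++ [d]) y (by rw [hX]; simp) hne (by simp) hxy hpred
      (by simpa using hsucc)
  subst hX₁
  have hX₂' : X₂' = [] := by
    by_contra hne
    exact inner (c :: X₁') x' X₂' y' (by simp [hX']) (by simp) hne hxy'
      (by simpa [getLast?_cons] using hpred') hsucc'
  subst hX₂'
  obtain ⟨rfl, rfl⟩ : c = x ∧ M = X₂ := by simpa using hX
  obtain ⟨rfl, rfl⟩ : M = X₁' ∧ d = x' := by
    have := List.append_inj' hX' (by simp)
    simpa using this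
  obtain ⟨hyX, hyb⟩ := third (X₁ := []) (X₂ := M ++ [d]) (by simp) hxy hpred
    (by simpa using hsucc)
  obtain ⟨hyX', hyb'⟩ := third (X₁ := c :: M) (X₂ := []) (by simp) hxy'
    (by simpa [getLast?_cons] using hpred') hsucc'
  have hnd := hcyc.2
  -- For a triangle the absence of `K₄ - e` makes `b`, `y` and `y'` distinct, and
  -- `NoTheta.not_triangle` applies. On a longer cycle the successor `e` of `c` is a third target,
  -- besides `a` and `y`, for the hubs `c` and `d`.
  cases M with
  | nil =>
    have hcd : G.Adj c d := by
      have := (hcyc.infix (l₁ := [c, d]) ⟨[a], [], by simp⟩).1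
      simpa using this
    have hby : b ≠ y := by
      rintro rfl
      exact hK b d a c (by grind) hac hab.symm hxy.symm hda hcd.symm
    have hby' : b ≠ y' := by
      rintro rfl
      exact hK b c a d (by grind) hda.symm hab.symm hxy'.symm hac.symm hcd
    have hyy' : y ≠ y' := by
      rintro rfl
      exact hK y a c d (by grind) hcd hxy.symm hxy'.symm hac hda.symm
    rcases ConnIn.diff_or_diff hyb hyb' hyy' with h1 | h1
    · exact hG.not_triangle hac hcd hda (by simp) (by simp) (by simp) hab hxy hxy' hby hyb h1
    · exact hG.not_triangle hda.symm hcd.symm hac.symm (by simp) (by simp) (by simp) hab hxy' hxy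
        hby' hyb' h1
  | cons e M =>
    have hce : G.Adj c e := by
      have := (hcyc.infix (l₁ := [c, e]) ⟨[a], M ++ [d], by simp⟩).1
      simpa using this
    refine hG.elim (p := c) (q := d) (w₀ := a) (w₁ := e) (w₂ := y) (S₀ := {c, a}) (S₁ := {c, e})
      (S₂ := {c, y}) (T₀ := {d, a}) (T₁ := {v | v ∈ e :: M ++ [d]})
      (T₂ := insert d {v | v ∉ a :: (c :: e :: M ++ [d])})
      (.of_adj hac.symm (by simp) (by simp)) (.of_adj hce (by simp) (by simp))
      (.of_adj hxy (by simp) (by simp)) (.of_adj hda (by simp) (by simp))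
      ((hcyc.infix (l₁ := e :: M ++ [d]) ⟨[a, c], [], by simp⟩).connIn (by simp) (by simp))
      ((ConnIn.of_adj hxy' (by simp) (.inr hyX')).trans
        ((hyb'.trans hyb.symm).mono (Set.subset_insert _ _)))
      ?_ ?_ ?_ ?_ ?_ ?_
    all_goals
      clear third hrot hmin hdeg hK hmax hlasso h hcyc hyb hyb' inner
      simp only [nodup_cons, List.nodup_append, mem_append, mem_cons, not_mem_nil, or_false,
        cons_append, Set.mem_insert_iff, Set.mem_singleton_iff, Set.mem_ofPred_eq] at hnd hyX ⊢
      grind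

end ToneColoring

/-! ### Computations with the fifteen pairs of colors. -/

namespace ToneColoring

/-- The two-element subsets of a six-element set. -/
def pairSet (i : Fin 15) : Finset (Fin 6) :=
  (![{0, 1}, {0, 2}, {0, 3}, {0, 4}, {0, 5}, {1, 2}, {1, 3}, {1, 4}, {1, 5}, {2, 3}, {2, 4}, {2, 5},
    {3, 4}, {3, 5}, {4, 5}] : Fin 15 → Finset (Fin 6)) i

/-- Disjointness of two pairs. The bit `15 * i + j` of the constant is set if and only if the pairs
with numbers `i` and `j` are disjoint. -/
def Dj (i j : Fin 15) : Bool :=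
  Nat.testBit 1012045315454360172905361713358041908008924197717441927854111620608 (15 * i + j)

/-- The pairs with numbers `i` and `j` have exactly one common element. The bit `15 * i + j` of the
constant is set if and only if this is so. -/
def Mt (i j : Fin 15) : Bool :=
  Nat.testBit 25947489969279751802431605811060123599981258492246300758903254581758 (15 * i + j)

theorem card_pairSet : ∀ i, (pairSet i).card = 2 := by decide +kernel

theorem dj_iff : ∀ i j, Dj i j = true ↔ Disjoint (pairSet i) (pairSet j) := by decide +kernel

theorem mt_iff : ∀ i j, Mt i j = true ↔ (pairSet i ∩ pairSet j).card = 1 := by decide +kernel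

theorem dj_symm : ∀ i j, Dj i j = Dj j i := by decide +kernel

theorem mt_symm : ∀ i j, Mt i j = Mt j i := by decide +kernel

theorem pairSet_injective : Function.Injective pairSet := by
  have : ∀ i j, pairSet i = pairSet j → i = j := by decide +kernel
  exact this

theorem exists_pairSet_eq : ∀ s : Finset (Fin 6), s.card = 2 → ∃ i, pairSet i = s := by
  decide +kernel

/-- The symmetric group acts transitively on the pairs of disjoint pairs. -/
theorem exists_equiv_of_dj {u v : Fin 15} (h : Dj u v) : ∃ σ : Fin 15 ≃ Fin 15, σ 0 = u ∧ σ 9 = v ∧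
    (∀ i j, Dj (σ i) (σ j) = Dj i j) ∧ ∀ i j, Mt (σ i) (σ j) = Mt i j := by
  obtain ⟨a, b, hab, hu⟩ := Finset.card_eq_two.1 (card_pairSet u)
  obtain ⟨c, d, hcd, hv⟩ := Finset.card_eq_two.1 (card_pairSet v)
  rw [dj_iff, hu, hv] at h
  have hinj : Function.Injective ![a, b, c, d] := by
    simp only [Finset.disjoint_insert_left, Finset.disjoint_singleton_left, Finset.mem_insert,
      Finset.mem_singleton, not_or] at h
    intro i j hij
    fin_cases i <;> fin_cases j <;> simp_all
  have hinj' : Function.Injective (![0, 1, 2, 3] : Fin 4 → Fin 6) := by decide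
  obtain ⟨π, hπ⟩ := (Equiv.Perm.isMultiplyPretransitive (Fin 6) 4).exists_smul_eq
    ⟨_, hinj'⟩ ⟨_, hinj⟩
  have hπ' := fun i ↦ congrArg (fun f : Fin 4 ↪ Fin 6 ↦ f i) hπ
  have h0 : π 0 = a := hπ' 0
  have h1 : π 1 = b := hπ' 1
  have h2 : π 2 = c := hπ' 2
  have h3 : π 3 = d := hπ' 3
  have hσ : ∀ i, ∃ j, pairSet j = (pairSet i).map π.toEmbedding := fun i ↦
    exists_pairSet_eq _ (by rw [Finset.card_map, card_pairSet])
  choose σ hσ using hσ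
  have hσinj : Function.Injective σ := fun i j hij ↦ pairSet_injective <|
    Finset.map_injective π.toEmbedding (by rw [← hσ, ← hσ, hij])
  refine ⟨Equiv.ofBijective σ (Finite.injective_iff_bijective.1 hσinj), ?_, ?_, ?_, ?_⟩
  · apply pairSet_injective
    rw [Equiv.ofBijective_apply, hσ, hu, ← h0, ← h1]
    simp [pairSet]
  · apply pairSet_injective
    rw [Equiv.ofBijective_apply, hσ, hv, ← h2, ← h3]
    rw [show pairSet 9 = {2, 3} from rfl]
    simp
  · intro i j
    rw [Bool.eq_iff_iff, dj_iff, dj_iff, Equiv.ofBijective_apply, Equiv.ofBijective_apply, hσ, hσ,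
      Finset.disjoint_map]
  · intro i j
    rw [Bool.eq_iff_iff, mt_iff, mt_iff, Equiv.ofBijective_apply, Equiv.ofBijective_apply, hσ, hσ,
      ← Finset.map_inter, Finset.card_map]

/-- The four colors outside `u` have three partitions into two pairs; `w` can be taken from a
partition that contains neither `a` nor `b`. -/
theorem exists_dj_mt_mt : ∀ u a b, Dj u a → Dj u b → ∃ w, Dj u w ∧ Mt a w ∧ Mt b w := by
  decide +kernel

/-- Take `w` to be the complement of `u ∪ v`: a pair disjoint from `u` that has one color in `v` has
its other color in `w`. -/
theorem exists_third_point : ∀ u v, Dj u v → ∃ w, (Dj u w ∧ Dj v w) ∧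
    (∀ x, Dj u x → Mt v x → Mt w x) ∧ ∀ x, Dj v x → Mt u x → Mt w x := by
  decide +kernel

/-- This colors an ear with two inner vertices: `u` and `v` belong to its ends, `u'` and `v'` to
their remaining neighbours. The conditions `Mt v a` and `Mt u b` come from the edge between the
ends. By symmetry only the pairs with numbers 0 and 9, that is `{0, 1}` and `{2, 3}`, have to be
checked for `u` and `v`. -/
theorem exists_two_steps {u v u' v' : Fin 15} (huv : Dj u v) (hu : Dj u u') (hv : Dj v v') :
    ∃ a, (Dj u a ∧ Mt v a ∧ Mt u' a) ∧ ∃ b, (Dj v b ∧ Mt u b ∧ Mt v' b) ∧ Dj a b := by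
  have key : ∀ u' v', Dj 0 u' → Dj 9 v' → ∃ a, (Dj 0 a ∧ Mt 9 a ∧ Mt u' a) ∧
      ∃ b, (Dj 9 b ∧ Mt 0 b ∧ Mt v' b) ∧ Dj a b := by decide +kernel
  obtain ⟨σ, rfl, rfl, hD, hM⟩ := exists_equiv_of_dj huv
  obtain ⟨u', rfl⟩ := σ.surjective u'
  obtain ⟨v', rfl⟩ := σ.surjective v'
  rw [hD] at hu hv
  obtain ⟨a, ha, b, hb, h⟩ := key u' v' hu hv
  exact ⟨σ a, by simpa only [hD, hM], σ b, by simpa only [hD, hM], by simpa only [hD, hM]⟩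

set_option synthInstance.maxSize 1000 in
theorem exists_three_steps {u v u' v' : Fin 15} (huv : Dj u v) (hu : Dj u u') (hv : Dj v v') :
    ∃ a, (Dj u a ∧ Mt v a ∧ Mt u' a) ∧ ∃ b, (Dj v b ∧ Mt u b ∧ Mt v' b) ∧ Mt a b ∧
      ∃ c, Dj a c ∧ Dj c b ∧ Mt u c ∧ Mt c v := by
  have key : ∀ u' v', Dj 0 u' → Dj 9 v' → ∃ a, (Dj 0 a ∧ Mt 9 a ∧ Mt u' a) ∧
      ∃ b, (Dj 9 b ∧ Mt 0 b ∧ Mt v' b) ∧ Mt a b ∧ ∃ c, Dj a c ∧ Dj c b ∧ Mt 0 c ∧ Mt c 9 := by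
    decide +kernel
  obtain ⟨σ, rfl, rfl, hD, hM⟩ := exists_equiv_of_dj huv
  obtain ⟨u', rfl⟩ := σ.surjective u'
  obtain ⟨v', rfl⟩ := σ.surjective v'
  rw [hD] at hu hv
  obtain ⟨a, ha, b, hb, h, c, hc⟩ := key u' v' hu hv
  exact ⟨σ a, by simpa only [hD, hM], σ b, by simpa only [hD, hM], by simpa only [hD, hM], σ c,
    by simpa only [hD, hM]⟩

set_option synthInstance.maxSize 1000 in
theorem exists_four_steps {u v u' v' : Fin 15} (huv : Dj u v) (hu : Dj u u') (hv : Dj v v') :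
    ∃ a, (Dj u a ∧ Mt v a ∧ Mt u' a) ∧ ∃ b, (Dj v b ∧ Mt u b ∧ Mt v' b) ∧
      ∃ c, (Dj a c ∧ Mt u c ∧ Mt c b) ∧ ∃ d, (Dj d b ∧ Mt d v) ∧ Dj c d ∧ Mt a d := by
  have key : ∀ u' v', Dj 0 u' → Dj 9 v' → ∃ a, (Dj 0 a ∧ Mt 9 a ∧ Mt u' a) ∧
      ∃ b, (Dj 9 b ∧ Mt 0 b ∧ Mt v' b) ∧
        ∃ c, (Dj a c ∧ Mt 0 c ∧ Mt c b) ∧ ∃ d, (Dj d b ∧ Mt d 9) ∧ Dj c d ∧ Mt a d := by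
    decide +kernel
  obtain ⟨σ, rfl, rfl, hD, hM⟩ := exists_equiv_of_dj huv
  obtain ⟨u', rfl⟩ := σ.surjective u'
  obtain ⟨v', rfl⟩ := σ.surjective v'
  rw [hD] at hu hv
  obtain ⟨a, ha, b, hb, c, hc, d, hd⟩ := key u' v' hu hv
  exact ⟨σ a, by simpa only [hD, hM], σ b, by simpa only [hD, hM], σ c, by simpa only [hD, hM],
    σ d, by simpa only [hD, hM]⟩

/-- The sequence `x, y, a, c, b, s, t` connects any two prescribed steps; from this length on, the
two ends of an ear can be colored independently of each other. -/
theorem exists_five_steps {x y s t : Fin 15} (hxy : Dj x y) (hst : Dj s t) :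
    ∃ a, (Dj y a ∧ Mt x a) ∧ ∃ b, (Dj b s ∧ Mt b t ∧ Mt a b) ∧
      ∃ c, Dj a c ∧ Dj c b ∧ Mt y c ∧ Mt c s := by
  have key : ∀ s t, Dj s t → ∃ a, (Dj 9 a ∧ Mt 0 a) ∧ ∃ b, (Dj b s ∧ Mt b t ∧ Mt a b) ∧
      ∃ c, Dj a c ∧ Dj c b ∧ Mt 9 c ∧ Mt c s := by decide +kernel
  obtain ⟨σ, rfl, rfl, hD, hM⟩ := exists_equiv_of_dj hxy
  obtain ⟨s, rfl⟩ := σ.surjective s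
  obtain ⟨t, rfl⟩ := σ.surjective t
  rw [hD] at hst
  obtain ⟨a, ha, b, hb, c, hc⟩ := key s t hst
  exact ⟨σ a, by simpa only [hD, hM], σ b, by simpa only [hD, hM], σ c, by simpa only [hD, hM]⟩

end ToneColoring

/-! ### Extension of colorings to pendant vertices and ears. -/

namespace ToneColoring

/-- The sequence is lengthened at its beginning: after `x, y` any pair `z` disjoint from `y` and
meeting `x` in one color may follow, and the induction hypothesis is applied to `y, z`. -/
theorem exists_long_walk (n : ℕ) {x y s t : Fin 15} (hxy : Dj x y) (hst : Dj s t) :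
    ∃ c : ℕ → Fin 15, c 0 = x ∧ c 1 = y ∧ c (n + 5) = s ∧ c (n + 6) = t ∧
      (∀ i ≤ n + 5, Dj (c i) (c (i + 1))) ∧ ∀ i ≤ n + 4, Mt (c i) (c (i + 2)) := by
  induction n generalizing x y with
  | zero =>
    obtain ⟨a, ⟨h1, h2⟩, b, ⟨h3, h4, h5⟩, c, h6, h7, h8, h9⟩ := exists_five_steps hxy hst
    refine ⟨fun i ↦ [x, y, a, c, b, s, t].getD i x, rfl, rfl, rfl, rfl, ?_, ?_⟩
    · intro i hi
      interval_cases i <;> assumption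
    · intro i hi
      interval_cases i <;> assumption
  | succ n ih =>
    obtain ⟨z, hz, hxz, -⟩ := exists_dj_mt_mt y x x (by rwa [dj_symm]) (by rwa [dj_symm])
    obtain ⟨c, h0, h1, h5, h6, hD, hM⟩ := ih hz
    refine ⟨fun i ↦ Nat.casesOn i x c, rfl, h0, h5, h6, ?_, ?_⟩
    · rintro (_ | i) hi
      · simpa [h0] using hxy
      · exact hD i (by omega)
    · rintro (_ | i) hi
      · simpa [h1] using hxz
      · exact hM i (by omega)

/-- A sequence of pairs by which a coloring can be extended to the inner vertices of an ear. -/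
theorem exists_walk {k : ℕ} (hk : 2 ≤ k) {u v u' v' : Fin 15} (huv : Dj u v) (hu : Dj u u')
    (hv : Dj v v') : ∃ c : ℕ → Fin 15, c 0 = u ∧ c (k + 1) = v ∧
      (∀ i ≤ k, Dj (c i) (c (i + 1))) ∧ (∀ i < k, Mt (c i) (c (i + 2))) ∧
      Mt v (c 1) ∧ Mt u' (c 1) ∧ Mt u (c k) ∧ Mt v' (c k) := by
  obtain rfl | rfl | rfl | ⟨n, rfl⟩ : k = 2 ∨ k = 3 ∨ k = 4 ∨ ∃ n, k = n + 5 := by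
    by_cases h : k < 5
    · omega
    · exact .inr (.inr (.inr ⟨k - 5, by omega⟩))
  · obtain ⟨a, ⟨h1, h2, h3⟩, b, ⟨h4, h5, h6⟩, h7⟩ := exists_two_steps huv hu hv
    have h4' := h4
    have h2' := h2
    rw [dj_symm] at h4'
    rw [mt_symm] at h2'
    refine ⟨fun i ↦ [u, a, b, v].getD i u, rfl, rfl, ?_, ?_, h2, h3, h5, h6⟩
    all_goals
      intro i hi
      interval_cases i <;> assumption
  · obtain ⟨a, ⟨h1, h2, h3⟩, b, ⟨h4, h5, h6⟩, h7, c, h8, h9, h10, h11⟩ :=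
      exists_three_steps huv hu hv
    have h4' := h4
    rw [dj_symm] at h4'
    refine ⟨fun i ↦ [u, a, c, b, v].getD i u, rfl, rfl, ?_, ?_, h2, h3, h5, h6⟩
    all_goals
      intro i hi
      interval_cases i <;> assumption
  · obtain ⟨a, ⟨h1, h2, h3⟩, b, ⟨h4, h5, h6⟩, c, ⟨h7, h8, h9⟩, d, ⟨h10, h11⟩, h12, h13⟩ :=
      exists_four_steps huv hu hv
    have h4' := h4
    rw [dj_symm] at h4'
    refine ⟨fun i ↦ [u, a, c, d, b, v].getD i u, rfl, rfl, ?_, ?_, h2, h3, h5, h6⟩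
    all_goals
      intro i hi
      interval_cases i <;> assumption
  · obtain ⟨a, ha, ha1, ha2⟩ := exists_dj_mt_mt u v u' huv hu
    obtain ⟨b, hb, hb1, hb2⟩ := exists_dj_mt_mt v u v' (by rwa [dj_symm]) hv
    obtain ⟨c, h0, h1, h5, h6, hD, hM⟩ := exists_long_walk n ha (show Dj b v by rwa [dj_symm])
    refine ⟨c, h0, h6, hD, fun i hi ↦ hM i (by omega), ?_, ?_, ?_, ?_⟩
    · rwa [h1]
    · rwa [h1]
    · rwa [h5]
    · rwa [h5]

/-- The local form of a good coloring by pairs. -/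
structure LocGood {V : Type*} (G : SimpleGraph V) (f : V → Fin 15) : Prop where
  dj : ∀ u v, G.Adj u v → Dj (f u) (f v)
  mt : ∀ x u v, G.Adj x u → G.Adj x v → u ≠ v → ¬ G.Adj u v → Mt (f u) (f v)

/-- The graph obtained from `G` by deleting all edges that meet `W`. -/
def isolate {V : Type*} (G : SimpleGraph V) (W : Set V) : SimpleGraph V where
  Adj x y := G.Adj x y ∧ x ∉ W ∧ y ∉ W
  symm := ⟨fun _ _ h ↦ ⟨h.1.symm, h.2.2, h.2.1⟩⟩
  loopless := ⟨fun _ h ↦ h.1.ne rfl⟩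

section Extension

variable {V : Type*} {G : SimpleGraph V}

theorem isolate_le (W : Set V) : isolate G W ≤ G := fun _ _ h ↦ h.1

theorem isolate_lt {W : Set V} {x y : V} (hx : x ∈ W) (h : G.Adj x y) : isolate G W < G :=
  lt_of_le_of_ne (isolate_le W) fun heq ↦ by
    rw [← heq] at h
    exact h.2.1 hx

theorem LocGood.of_isolate {W : Set V} {f' f : V → Fin 15} (hf' : LocGood (isolate G W) f')
    (hf : ∀ x ∉ W, f x = f' x) (hdj : ∀ x ∈ W, ∀ y, G.Adj x y → Dj (f x) (f y))
    (hin : ∀ x ∈ W, ∀ p q, G.Adj x p → G.Adj x q → p ≠ q → ¬ G.Adj p q → Mt (f p) (f q))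
    (hout : ∀ x ∉ W, ∀ p ∈ W, ∀ q, G.Adj x p → G.Adj x q → p ≠ q → ¬ G.Adj p q →
      Mt (f p) (f q)) : LocGood G f := by
  refine ⟨fun x y hxy ↦ ?_, fun x p q hxp hxq hpq hnpq ↦ ?_⟩
  · by_cases hx : x ∈ W
    · exact hdj x hx y hxy
    by_cases hy : y ∈ W
    · rw [dj_symm]
      exact hdj y hy x hxy.symm
    rw [hf x hx, hf y hy]
    exact hf'.dj x y ⟨hxy, hx, hy⟩
  · by_cases hx : x ∈ W
    · exact hin x hx p q hxp hxq hpq hnpq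
    by_cases hp : p ∈ W
    · exact hout x hx p hp q hxp hxq hpq hnpq
    by_cases hq : q ∈ W
    · rw [mt_symm]
      exact hout x hx q hq p hxq hxp hpq.symm fun h ↦ hnpq h.symm
    rw [hf p hp, hf q hq]
    exact hf'.mt x p q ⟨hxp, hx, hp⟩ ⟨hxq, hx, hq⟩ hpq fun h ↦ hnpq h.1

theorem exists_dj : ∀ u, ∃ a, Dj u a := by decide +kernel

theorem exists_locGood_of_pendant (hdeg : ∀ v x y z w, G.Adj v x → G.Adj v y → G.Adj v z →
      G.Adj v w → [x, y, z, w].Nodup → False) {x p : V} (hxp : G.Adj x p)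
    (hx : ∀ z, G.Adj x z → z = p) {f' : V → Fin 15} (hf' : LocGood (isolate G {x}) f') :
    ∃ f, LocGood G f := by
  classical
  -- By the degree bound `p` has at most two neighbours besides `x`. If there are fewer, a color is
  -- repeated, or an arbitrary pair disjoint from that of `p` is used.
  have hnb : ∃ a b, Dj (f' p) a ∧ Dj (f' p) b ∧ ∀ z, G.Adj p z → z ≠ x → f' z = a ∨ f' z = b := by
    have hD : ∀ z, G.Adj p z → z ≠ x → Dj (f' p) (f' z) := fun z hz hzx ↦
      hf'.dj p z ⟨hz, hxp.ne', hzx⟩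
    by_cases h1 : ∃ z₁, G.Adj p z₁ ∧ z₁ ≠ x
    · obtain ⟨z₁, h1, h1x⟩ := h1
      by_cases h2 : ∃ z₂, G.Adj p z₂ ∧ z₂ ≠ x ∧ z₂ ≠ z₁
      · obtain ⟨z₂, h2, h2x, h21⟩ := h2
        refine ⟨f' z₁, f' z₂, hD _ h1 h1x, hD _ h2 h2x, fun z hz hzx ↦ ?_⟩
        by_contra! hcon
        have hz1 : z ≠ z₁ := fun h ↦ hcon.1 (h ▸ rfl)
        have hz2 : z ≠ z₂ := fun h ↦ hcon.2 (h ▸ rfl)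
        exact hdeg p x z₁ z₂ z hxp.symm h1 h2 hz
          (by simp [h1x.symm, h2x.symm, hzx.symm, h21.symm, hz1.symm, hz2.symm])
      · refine ⟨f' z₁, f' z₁, hD _ h1 h1x, hD _ h1 h1x, fun z hz hzx ↦ ?_⟩
        by_contra! hcon
        exact h2 ⟨z, hz, hzx, fun h ↦ hcon.1 (h ▸ rfl)⟩
    · obtain ⟨a, ha⟩ := exists_dj (f' p)
      exact ⟨a, a, ha, ha, fun z hz hzx ↦ (h1 ⟨z, hz, hzx⟩).elim⟩
  obtain ⟨a, b, ha, hb, hab⟩ := hnb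
  obtain ⟨w, hw, hwa, hwb⟩ := exists_dj_mt_mt _ a b ha hb
  refine ⟨Function.update f' x w, hf'.of_isolate ?_ ?_ ?_ ?_⟩
  · intro y hy
    exact Function.update_of_ne hy _ _
  · rintro _ rfl y hxy
    rw [hx y hxy, Function.update_self, Function.update_of_ne hxp.ne', dj_symm]
    exact hw
  · rintro _ rfl q r hq hr hqr
    exact (hqr ((hx q hq).trans (hx r hr).symm)).elim
  · rintro y hy _ rfl q hyx hyq hxq -
    obtain rfl := hx y hyx.symm
    rw [Function.update_self, Function.update_of_ne hxq.symm, mt_symm]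
    rcases hab q hyq hxq.symm with h | h <;> rw [h] <;> assumption

/-- A path `w 0, …, w (k + 1)` with adjacent ends whose inner vertices have degree two. -/
structure IsEar (G : SimpleGraph V) (k : ℕ) (w : ℕ → V) : Prop where
  pos : 0 < k
  inj : ∀ i j, i ≤ k + 1 → j ≤ k + 1 → w i = w j → i = j
  adj : ∀ i ≤ k, G.Adj (w i) (w (i + 1))
  chord : G.Adj (w 0) (w (k + 1))
  eq_or_eq : ∀ i < k, ∀ z, G.Adj (w (i + 1)) z → z = w i ∨ z = w (i + 2)

/-- The inner vertices of an ear. -/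
def innerVertices (k : ℕ) (w : ℕ → V) : Set V := {x | ∃ i < k, w (i + 1) = x}

theorem IsEar.zero_notMem {k : ℕ} {w : ℕ → V} (h : IsEar G k w) : w 0 ∉ innerVertices k w := by
  rintro ⟨i, hi, hw⟩
  have := h.inj _ _ (by omega) (by omega) hw
  omega

theorem IsEar.last_notMem {k : ℕ} {w : ℕ → V} (h : IsEar G k w) :
    w (k + 1) ∉ innerVertices k w := by
  rintro ⟨i, hi, hw⟩
  have := h.inj _ _ (by omega) (by omega) hw
  omega

/-- Inner vertices have no neighbours off the ear, so new conditions at distance two arise only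
between vertices two steps apart on the ear (`hM`), and between `w 1` or `w k` and the outside
neighbours of the adjacent end (`h1`, `h2`). The other end of the ear is among these neighbours. -/
theorem IsEar.exists_locGood {k : ℕ} {w : ℕ → V} (h : IsEar G k w) {f' : V → Fin 15}
    (hf' : LocGood (isolate G (innerVertices k w)) f') {c : ℕ → Fin 15} (hc0 : c 0 = f' (w 0))
    (hck : c (k + 1) = f' (w (k + 1))) (hD : ∀ i ≤ k, Dj (c i) (c (i + 1)))
    (hM : ∀ i < k, ¬ G.Adj (w i) (w (i + 2)) → Mt (c i) (c (i + 2)))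
    (h1 : ∀ q, G.Adj (w 0) q → q ∉ innerVertices k w → ¬ G.Adj (w 1) q → Mt (c 1) (f' q))
    (h2 : ∀ q, G.Adj (w (k + 1)) q → q ∉ innerVertices k w → ¬ G.Adj (w k) q → Mt (c k) (f' q)) :
    ∃ f, LocGood G f := by
  classical
  obtain ⟨f, hfw, hf⟩ : ∃ f : V → Fin 15, (∀ i < k, f (w (i + 1)) = c (i + 1)) ∧
      ∀ x ∉ innerVertices k w, f x = f' x := by
    -- Injectivity of `w` on the ear makes the chosen index the right one.
    refine ⟨fun x ↦ if hx : ∃ i < k, w (i + 1) = x then c (hx.choose + 1) else f' x, ?_, ?_⟩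
    · intro i hi
      have hx : ∃ j < k, w (j + 1) = w (i + 1) := ⟨i, hi, rfl⟩
      have := h.inj _ _ (by have := hx.choose_spec.1; omega) (by omega) hx.choose_spec.2
      simp only [dif_pos hx]
      rw [this]
    · intro x hx
      exact dif_neg hx
  have hfc : ∀ i ≤ k + 1, f (w i) = c i := by
    intro i hi
    rcases Nat.eq_zero_or_pos i with rfl | hi0
    · rw [hf _ h.zero_notMem, hc0]
    obtain ⟨i, rfl⟩ := Nat.exists_eq_succ_of_ne_zero hi0.ne'
    rcases Nat.lt_or_ge i k with hik | hik
    · exact hfw i hik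
    · obtain rfl : i = k := by omega
      rw [hf _ h.last_notMem, hck]
  refine ⟨f, hf'.of_isolate hf ?_ ?_ ?_⟩
  · rintro _ ⟨i, hi, rfl⟩ y hy
    rcases h.eq_or_eq i hi y hy with rfl | rfl
    · rw [hfc _ (by omega), hfc _ (by omega), dj_symm]
      exact hD i hi.le
    · rw [hfc _ (by omega), hfc _ (by omega)]
      exact hD (i + 1) hi
  · rintro _ ⟨i, hi, rfl⟩ p q hp hq hpq hnpq
    rcases h.eq_or_eq i hi p hp with rfl | rfl <;> rcases h.eq_or_eq i hi q hq with rfl | rfl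
    · exact (hpq rfl).elim
    · rw [hfc _ (by omega), hfc _ (by omega)]
      exact hM i hi hnpq
    · rw [hfc _ (by omega), hfc _ (by omega), mt_symm]
      exact hM i hi fun h ↦ hnpq h.symm
    · exact (hpq rfl).elim
  · rintro x hx _ ⟨i, hi, rfl⟩ q hxp hxq hpq hnpq
    rcases h.eq_or_eq i hi x hxp.symm with rfl | rfl
    · obtain rfl : i = 0 := by
        by_contra hi0
        exact hx ⟨i - 1, by omega, by congr 1; omega⟩
      have hq : q ∉ innerVertices k w := by
        rintro ⟨j, hj, rfl⟩
        rcases h.eq_or_eq j hj _ hxq.symm with h' | h'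
        · have := h.inj _ _ (by omega) (by omega) h'
          subst this
          exact hpq rfl
        · have := h.inj _ _ (by omega) (by omega) h'
          omega
      rw [hfc _ (by omega), hf q hq]
      exact h1 q hxq hq hnpq
    · obtain rfl : k = i + 1 := by
        by_contra hi0
        exact hx ⟨i + 1, by omega, rfl⟩
      have hq : q ∉ innerVertices (i + 1) w := by
        rintro ⟨j, hj, rfl⟩
        rcases h.eq_or_eq j hj _ hxq.symm with h' | h'
        · have := h.inj _ _ (by omega) (by omega) h'
          omega
        · have := h.inj _ _ (by omega) (by omega) h'
          obtain rfl : i = j := by omega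
          exact hpq rfl
      rw [hfc _ (by omega), hf q hq]
      exact h2 q hxq hq hnpq

end Extension

end ToneColoring

/-! ### The induction and the translation into tone colorings. -/

namespace ToneColoring

section

variable {V : Type*} {G : SimpleGraph V}

theorem EarList.exists_isEar {u v : V} {W : List V} (h : EarList G u W v) :
    ∃ k w, IsEar G k w ∧ innerVertices k w = {x | x ∈ W} := by
  set l := u :: (W ++ [v]) with hl
  have hlen : l.length = W.length + 2 := by simp [hl]
  have hget : ∀ i (hi : i < l.length), l.getD i u = l[i] := fun i hi ↦
    List.getD_eq_getElem _ _ hi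
  have hW : ∀ i (hi : i < W.length), l.getD (i + 1) u = W[i] := by
    intro i hi
    rw [hget _ (by omega)]
    simp [hl, List.getElem_append_left hi]
  refine ⟨W.length, fun i ↦ l.getD i u, ⟨List.length_pos_iff.2 h.ne_nil, ?_, ?_, ?_, ?_⟩, ?_⟩
  · intro i j hi hj hij
    rw [hget i (by omega), hget j (by omega)] at hij
    exact (h.pathList.2.getElem_inj_iff).1 hij
  · intro i hi
    rw [hget i (by omega), hget (i + 1) (by omega)]
    exact h.pathList.1.getElem i _
  · simpa [hl] using h.adj.symm
  · intro i hi z hz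
    rw [hW i hi] at hz
    have hsplit : W = W.take i ++ W[i] :: W.drop (i + 1) := by simp
    rcases h.eq_or_eq _ _ _ hsplit z hz with h' | h'
    · left
      rw [hget i (by omega)]
      have h1 : (u :: W.take i).getLast? = l[i]? := by
        have h2 : u :: W.take i = l.take (i + 1) := by
          simp [hl, List.take_append_of_le_length hi.le]
        rw [h2, List.getLast?_take]
        simp [List.getElem?_eq_getElem (show i < l.length by omega)]
      rw [h1, List.getElem?_eq_getElem (show i < l.length by omega)] at h'
      exact (Option.some.inj h').symm
    · right
      have h1 : (W.drop (i + 1) ++ [v]).head? = l[i + 2]? := by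
        have h2 : W.drop (i + 1) ++ [v] = l.drop (i + 2) := by
          simp [hl, List.drop_append_of_le_length (show i + 1 ≤ W.length from hi)]
        rw [h2, List.head?_drop]
      rw [hget (i + 2) (by omega)]
      rw [h1, List.getElem?_eq_getElem (show i + 2 < l.length by omega)] at h'
      exact (Option.some.inj h').symm
  · ext x
    constructor
    · rintro ⟨i, hi, rfl⟩
      dsimp only
      rw [hW i hi]
      exact List.getElem_mem hi
    · intro hx
      obtain ⟨i, hi, rfl⟩ := List.getElem_of_mem hx
      exact ⟨i, hi, hW i hi⟩

/-- The colors of the neighbours of the end `p` of an ear that are neither its other end `q` nor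
on the ear. -/
theorem exists_third_color (hdeg : ∀ v x y z w, G.Adj v x → G.Adj v y → G.Adj v z →
      G.Adj v w → [x, y, z, w].Nodup → False) {W : Set V} {p q r : V} (hpq : G.Adj p q)
    (hpr : G.Adj p r) (hr : r ∈ W) (hp : p ∉ W) (hq : q ∉ W) {f' : V → Fin 15}
    (hf' : LocGood (isolate G W) f') :
    ∃ a, Dj (f' p) a ∧ ∀ z, G.Adj p z → z ∉ W → z ≠ q → f' z = a := by
  by_cases h : ∃ z, G.Adj p z ∧ z ∉ W ∧ z ≠ q
  · obtain ⟨y, hy, hyW, hyq⟩ := h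
    refine ⟨f' y, hf'.dj p y ⟨hy, hp, hyW⟩, fun z hz hzW hzq ↦ ?_⟩
    by_contra hne
    have h1 : y ≠ z := by rintro rfl; exact hne rfl
    have h2 : r ≠ q := by rintro rfl; exact hq hr
    have h3 : r ≠ y := by rintro rfl; exact hyW hr
    have h4 : r ≠ z := by rintro rfl; exact hzW hr
    exact hdeg p r q y z hpr hpq hy hz (by simp [h1, h2, h3, h4, hyq.symm, hzq.symm])
  -- Without a further neighbour any pair disjoint from `f' p` serves; that of the other end is at
  -- hand.
  · exact ⟨f' q, hf'.dj p q ⟨hpq, hp, hq⟩, fun z hz hzW hzq ↦ (h ⟨z, hz, hzW, hzq⟩).elim⟩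

/-- For `k = 1` the only candidate is the complement of the colors of the ends. A further neighbour
`q` of one end is not adjacent to the other, as the triangle on the ear would become a `K₄ - e`;
hence `q` shares one color with the other end, and by `exists_third_point` one with the new vertex.
For `k ≥ 2` the colors come from `exists_walk`. -/
theorem IsEar.exists_extension (hdeg : ∀ v x y z w, G.Adj v x → G.Adj v y → G.Adj v z →
      G.Adj v w → [x, y, z, w].Nodup → False)
    (hK : ∀ u v x y, u ≠ v → G.Adj x y → G.Adj u x → G.Adj u y → G.Adj v x → G.Adj v y → False)
    {k : ℕ} {w : ℕ → V} (h : IsEar G k w) {f' : V → Fin 15}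
    (hf' : LocGood (isolate G (innerVertices k w)) f') : ∃ f, LocGood G f := by
  have hk := h.pos
  have hu := h.zero_notMem
  have hv := h.last_notMem
  have huv : Dj (f' (w 0)) (f' (w (k + 1))) := hf'.dj _ _ ⟨h.chord, hu, hv⟩
  obtain rfl | hk2 : k = 1 ∨ 2 ≤ k := by omega
  · obtain ⟨a, ⟨ha0, ha2⟩, hua, hva⟩ := exists_third_point _ _ huv
    have h01 := h.adj 0 (by omega)
    have h12 := h.adj 1 (by omega)
    have hw1 : ∀ q, q ∉ innerVertices 1 w → w 1 ≠ q := by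
      rintro q hq rfl
      exact hq ⟨0, by omega, rfl⟩
    refine h.exists_locGood hf' (c := fun i ↦ [f' (w 0), a, f' (w 2)].getD i a) rfl rfl ?_ ?_ ?_ ?_
    · intro i hi
      rw [dj_symm] at ha2
      interval_cases i <;> assumption
    · intro i hi hnadj
      obtain rfl : i = 0 := by omega
      exact (hnadj h.chord).elim
    · intro q hq hqW hnadj
      have hq2 : q ≠ w 2 := by rintro rfl; exact hnadj h12
      have hnq : ¬ G.Adj (w 2) q := fun h2q ↦
        hK (w 1) q (w 0) (w 2) (hw1 q hqW) h.chord h01.symm h12 hq.symm h2q.symm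
      exact hua _ (hf'.dj _ _ ⟨hq, hu, hqW⟩)
        (hf'.mt (w 0) (w 2) q ⟨h.chord, hu, hv⟩ ⟨hq, hu, hqW⟩ hq2.symm fun h ↦ hnq h.1)
    · intro q hq hqW hnadj
      have hq2 : q ≠ w 0 := by rintro rfl; exact hnadj h01.symm
      have hnq : ¬ G.Adj (w 0) q := fun h2q ↦
        hK (w 1) q (w 0) (w 2) (hw1 q hqW) h.chord h01.symm h12 h2q.symm hq.symm
      exact hva _ (hf'.dj _ _ ⟨hq, hv, hqW⟩)
        (hf'.mt (w 2) (w 0) q ⟨h.chord.symm, hv, hu⟩ ⟨hq, hv, hqW⟩ hq2.symm fun h ↦ hnq h.1)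
  · have hin1 : w 1 ∈ innerVertices k w := ⟨0, by omega, rfl⟩
    have hink : w k ∈ innerVertices k w := ⟨k - 1, by omega, by congr 1; omega⟩
    obtain ⟨a, ha, hua⟩ := exists_third_color hdeg h.chord (h.adj 0 (by omega)) hin1 hu hv hf'
    obtain ⟨b, hb, hvb⟩ := exists_third_color hdeg h.chord.symm (h.adj k le_rfl).symm hink hv hu hf'
    obtain ⟨c, hc0, hck, hD, hM, h1, h2, h3, h4⟩ := exists_walk hk2 huv ha hb
    refine h.exists_locGood hf' hc0 hck hD (fun i hi _ ↦ hM i hi) ?_ ?_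
    · intro q hq hqW _
      rw [mt_symm]
      by_cases hqv : q = w (k + 1)
      · rwa [hqv]
      · rwa [hua q hq hqW hqv]
    · intro q hq hqW _
      rw [mt_symm]
      by_cases hqu : q = w 0
      · rwa [hqu]
      · rwa [hvb q hq hqW hqu]

/-- The induction runs over the subgraph order on a fixed vertex set: deleted vertices stay as
isolated ones, and all three hypotheses pass to subgraphs. -/
theorem exists_locGood [Fintype V] (G : SimpleGraph V)
    (hdeg : ∀ v x y z w, G.Adj v x → G.Adj v y → G.Adj v z → G.Adj v w →
      [x, y, z, w].Nodup → False)
    (hK : ∀ u v x y, u ≠ v → G.Adj x y → G.Adj u x → G.Adj u y → G.Adj v x → G.Adj v y → False)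
    (hG : NoTheta G) : ∃ f, LocGood G f := by
  induction G using WellFoundedLT.induction with
  | _ G ih =>
    have step : ∀ (W : Set V) x y, x ∈ W → G.Adj x y → ∃ f', LocGood (isolate G W) f' :=
      fun W x y hx hxy ↦ ih _ (isolate_lt hx hxy)
        (fun v x y z w h1 h2 h3 h4 ↦ hdeg v x y z w h1.1 h2.1 h3.1 h4.1)
        (fun u v x y huv h1 h2 h3 h4 h5 ↦ hK u v x y huv h1.1 h2.1 h3.1 h4.1 h5.1)
        (hG.mono (isolate_le W))
    by_cases hedge : ∃ s t, G.Adj s t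
    · obtain ⟨s, t, hst⟩ := hedge
      by_cases hmin : ∀ v u, G.Adj v u → ∃ z, G.Adj v z ∧ z ≠ u
      · obtain ⟨u, W, v, hear⟩ := exists_earList hmin hdeg hK hG hst
        obtain ⟨k, w, hw, hWw⟩ := hear.exists_isEar
        obtain ⟨f', hf'⟩ := step (innerVertices k w) (w 1) (w 2) ⟨0, hw.pos, rfl⟩
          (hw.adj 1 hw.pos)
        exact hw.exists_extension hdeg hK hf'
      · push Not at hmin
        obtain ⟨x, p, hxp, hx⟩ := hmin
        obtain ⟨f', hf'⟩ := step {x} x p rfl hxp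
        exact exists_locGood_of_pendant hdeg hxp hx hf'
    · exact ⟨fun _ ↦ 0, fun u v huv ↦ (hedge ⟨u, v, huv⟩).elim,
        fun x u v hxu ↦ (hedge ⟨x, u, hxu⟩).elim⟩

theorem exists_adj_adj_of_edist_eq_two {u v : V} (h : G.edist u v = 2) :
    u ≠ v ∧ ¬ G.Adj u v ∧ ∃ x, G.Adj x u ∧ G.Adj x v := by
  have hreach : G.Reachable u v := by
    rw [← SimpleGraph.edist_ne_top_iff_reachable, h]
    exact ENat.natCast_ne_top 2
  obtain ⟨p, hp⟩ := hreach.exists_walk_length_eq_edist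
  rw [h] at hp
  have hp2 : p.length = 2 := by exact_mod_cast hp
  refine ⟨?_, ?_, ?_⟩
  · rintro rfl
    simp at h
  · intro hadj
    rw [SimpleGraph.edist_eq_one_iff_adj.2 hadj] at h
    exact absurd h (by decide)
  · refine ⟨p.getVert 1, ?_, ?_⟩
    · have := p.adj_getVert_succ (i := 0) (by omega)
      simpa using this.symm
    · have := p.adj_getVert_succ (i := 1) (by omega)
      have h2 : p.getVert 2 = v := by rw [← hp2, p.getVert_length]
      simpa [h2] using this

/-- Pairs share at most two colors, so only distances one and two impose a condition; vertices at
distance two are distinct, nonadjacent and have a common neighbour. -/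
theorem LocGood.isGoodTwoToneColoring {f : V → Fin 15} (hf : LocGood G f) :
    IsGoodTwoToneColoring G 6 fun v ↦ pairSet (f v) := by
  have hone : ∀ u v, G.edist u v = 2 → (pairSet (f u) ∩ pairSet (f v)).card = 1 := by
    intro u v h
    obtain ⟨hne, hnadj, x, hxu, hxv⟩ := exists_adj_adj_of_edist_eq_two h
    exact (mt_iff _ _).1 (hf.mt x u v hxu hxv hne hnadj)
  refine ⟨⟨fun v ↦ card_pairSet _, fun u v huv ↦ ?_⟩, hone⟩
  by_contra! hle
  have hcard : (pairSet (f u) ∩ pairSet (f v)).card ≤ 2 :=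
    (Finset.card_le_card Finset.inter_subset_left).trans (card_pairSet _).le
  have hpos : G.edist u v ≠ 0 := by rwa [Ne, SimpleGraph.edist_eq_zero_iff]
  obtain ⟨n, hn⟩ := ENat.ne_top_iff_exists.1 (hle.trans_lt (ENat.natCast_lt_top _)).ne
  rw [← hn] at hle hpos
  have hle' : n ≤ (pairSet (f u) ∩ pairSet (f v)).card := by exact_mod_cast hle
  have hpos' : n ≠ 0 := by exact_mod_cast hpos
  obtain rfl | rfl : n = 1 ∨ n = 2 := by omega
  · have hadj : G.Adj u v := SimpleGraph.edist_eq_one_iff_adj.1 hn.symm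
    have := (dj_iff _ _).1 (hf.dj u v hadj)
    rw [Finset.disjoint_iff_inter_eq_empty] at this
    rw [this] at hle'
    simp at hle'
  · have := hone u v hn.symm
    omega

theorem k4MinusEdge_isContained {u v x y : V} (huv : u ≠ v) (hxy : G.Adj x y) (hux : G.Adj u x)
    (huy : G.Adj u y) (hvx : G.Adj v x) (hvy : G.Adj v y) : K4MinusEdge.IsContained G := by
  refine ⟨⟨⟨![u, v, x, y], ?_⟩, ?_⟩⟩
  · intro i j hij
    have hij' : i ≠ j ∧ s(i, j) ≠ s(0, 1) := by simpa [K4MinusEdge] using hij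
    revert hij'
    have := hxy.symm; have := hux.symm; have := huy.symm; have := hvx.symm; have := hvy.symm
    fin_cases i <;> fin_cases j <;> simp_all
  · intro i j hij
    have := hxy.ne; have := hux.ne; have := huy.ne; have := hvx.ne; have := hvy.ne
    fin_cases i <;> fin_cases j <;> simp_all

/-- The colors of vertices 2 and 3 leave exactly two colors, which both 0 and 1 must take, although
these are at distance at most two. -/
theorem not_isGoodTwoToneColoring (h : K4MinusEdge.IsContained G) (f : V → Finset (Fin 6)) :
    ¬ IsGoodTwoToneColoring G 6 f := by
  intro hf
  obtain ⟨φ⟩ := h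
  have hinj := φ.injective
  have hadj : ∀ i j, K4MinusEdge.Adj i j → Disjoint (f (φ i)) (f (φ j)) := by
    intro i j hij
    have hG : G.Adj (φ i) (φ j) := φ.toHom.map_adj hij
    have := hf.isToneColoring.card_inter_lt _ _ hG.ne
    rw [SimpleGraph.edist_eq_one_iff_adj.2 hG] at this
    have : (f (φ i) ∩ f (φ j)).card < 1 := by exact_mod_cast this
    rw [Finset.disjoint_iff_inter_eq_empty, ← Finset.card_eq_zero]
    omega
  have h23 := hadj 2 3 (by simp [K4MinusEdge])
  have h02 := hadj 0 2 (by simp [K4MinusEdge])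
  have h03 := hadj 0 3 (by simp [K4MinusEdge])
  have h12 := hadj 1 2 (by simp [K4MinusEdge])
  have h13 := hadj 1 3 (by simp [K4MinusEdge])
  have hcard := hf.isToneColoring.card_eq
  have hcompl : ∀ i, Disjoint (f (φ i)) (f (φ 2)) → Disjoint (f (φ i)) (f (φ 3)) →
      f (φ i) = (f (φ 2) ∪ f (φ 3))ᶜ := by
    intro i h2 h3
    refine Finset.eq_of_subset_of_card_le ?_ ?_
    · rw [Finset.subset_compl_iff_disjoint_right, Finset.disjoint_union_right]
      exact ⟨h2, h3⟩
    · rw [Finset.card_compl, Finset.card_union_of_disjoint h23, hcard, hcard, hcard]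
      decide
  have heq : f (φ 0) = f (φ 1) := (hcompl 0 h02 h03).trans (hcompl 1 h12 h13).symm
  have hlt := hf.isToneColoring.card_inter_lt (φ 0) (φ 1) (hinj.ne (by decide))
  rw [heq, Finset.inter_self, hcard] at hlt
  have h2 : G.edist (φ 0) (φ 1) ≤ 2 := by
    have h02 : G.Adj (φ 0) (φ 2) := φ.toHom.map_adj (by simp [K4MinusEdge])
    have h21 : G.Adj (φ 2) (φ 1) := φ.toHom.map_adj (by simp [K4MinusEdge])
    exact (SimpleGraph.Walk.cons h02 (.cons h21 .nil)).edist_le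
  exact absurd (hlt.trans_le h2) (lt_irrefl _)

theorem not_nodup_of_maxDegree_le [Fintype V] [DecidableRel G.Adj] (hdeg : G.maxDegree ≤ 3)
    (v x y z w : V) (hx : G.Adj v x) (hy : G.Adj v y) (hz : G.Adj v z) (hw : G.Adj v w)
    (h : [x, y, z, w].Nodup) : False := by
  classical
  have h1 : [x, y, z, w].toFinset ⊆ G.neighborFinset v := by
    intro a ha
    simp only [List.toFinset_cons, List.toFinset_nil, Finset.mem_insert, Finset.notMem_empty,
      or_false] at ha
    rw [SimpleGraph.mem_neighborFinset]
    rcases ha with rfl | rfl | rfl | rfl <;> assumption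
  have h2 := Finset.card_le_card h1
  rw [List.toFinset_card_of_nodup h, SimpleGraph.card_neighborFinset_eq_degree] at h2
  have h3 := G.degree_le_maxDegree v
  simp only [List.length_cons, List.length_nil] at h2
  omega

end

end ToneColoring

theorem theoremt2 {V : Type*} [Fintype V] (G : SimpleGraph V) [DecidableRel G.Adj]
    (hdeg : G.maxDegree ≤ 3) (hout : ToneColoring.IsOuterplanar G) :
    ((∃ f : V → Finset (Fin 6), ToneColoring.IsGoodTwoToneColoring G 6 f) ↔
      ¬ ToneColoring.K4MinusEdge.IsContained G) ∧
    (¬ ToneColoring.K4MinusEdge.IsContained G →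
      ∃ f : V → Finset (Fin 6), ToneColoring.IsToneColoring G 2 6 f) := by
  have key : ¬ ToneColoring.K4MinusEdge.IsContained G →
      ∃ f : V → Finset (Fin 6), ToneColoring.IsGoodTwoToneColoring G 6 f := by
    intro hK
    obtain ⟨f, hf⟩ := ToneColoring.exists_locGood G
      (ToneColoring.not_nodup_of_maxDegree_le hdeg)
      (fun u v x y huv hxy hux huy hvx hvy ↦
        hK (ToneColoring.k4MinusEdge_isContained huv hxy hux huy hvx hvy)) hout.noTheta
    exact ⟨_, hf.isGoodTwoToneColoring⟩
  refine ⟨⟨?_, key⟩, fun hK ↦ ?_⟩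
  · rintro ⟨f, hf⟩ hK
    exact ToneColoring.not_isGoodTwoToneColoring hK f hf
  · obtain ⟨f, hf⟩ := key hK
    exact ⟨f, hf.isToneColoring⟩
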